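/- Let $\mathbb{O}$ be the octonions $z = x_0 + x_1e_1 + \dots + x_7e_7$ with Euclidean norm $|z|$, conjugate $\overline{z}$ and real part $\Re z = x_0$. A real differentiable function $f$ on an open set is called left $\mathbb{O}$-regular if $\frac{\partial f}{\partial x_0} + \sum_{i=1}^7 e_i\frac{\partial f}{\partial x_i} = 0$. Let $d>0$ and let $\mathcal{S} = \{z\in\mathbb{O} : 0<\Re z<d\}$. Let $dS$ be the surface measure on $\partial\mathcal{S}$, i.e. $7$-dimensional Lebesgue measure on the two hyperplanes $\Re z=0$ and $\Re z=d$. Let $\mathcal{A}(\mathcal{S})$ be the set of functions $f:\overline{\mathcal S}\to\mathbb{O}$ that are left $\mathbb{O}$-regular in $\mathcal{S}$, continuous on $\overline{\mathcal{S}}$, and satisfy $$\sup_{0\le t\le d}\int_{\mathbb{R}^7}|f(t+x_1e_1+\dots+x_7e_7)|^2\,dx_1\cdots dx_7<\infty .$$ The Hardy space $H^2(\mathcal{S})$ is the closure of $\mathcal{A}(\mathcal{S})$ in the $L^2(\partial\mathcal{S})$-norm. Its elements are the left $\mathbb{O}$-regular functions $f$ on $\mathcal{S}$, together with boundary values in $L^2(\partial\mathcal{S})$,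 for which there are $u_k\in\mathcal{A}(\mathcal{S})$ with $u_k\to f$ in $L^2(\partial\mathcal{S})$ and $u_k\to f$ pointwise in $\mathcal{S}$. Put $$(f,g)_{\partial\mathcal{S}}=\frac{3}{\pi^4}\int_{\partial\mathcal{S}}\overline{g(z)}\,f(z)\,dS(z).$$ A Szegő kernel of $\mathcal{S}$ is a function $K(z,w)$ such that for every $w\in\mathcal{S}$ one has $K(\cdot,w)\in H^2(\mathcal{S})$ and $f(w)=(f,K(\cdot,w))_{\partial\mathcal{S}}$ for all $f\in H^2(\mathcal{S})$. **Theorem.** For $w\in\mathcal{S}$ and $z\in\overline{\mathcal{S}}$ the series $$S_{\mathcal S}(z,w)=\sum_{n=-\infty}^{+\infty}(-1)^n\frac{\overline{z}+w+2dn}{|\overline{z}+w+2dn|^8}$$ converges unconditionally, and $S_{\mathcal{S}}$ is a Szegő kernel of $\mathcal{S}$. It is the only one: if $K$ is a Szegő kernel of $\mathcal{S}$, then for every $w\in\mathcal{S}$ one has $K(z,w)=S_{\mathcal{S}}(z,w)$ for all $z\in\mathcal{S}$ and for almost every $z\in\partial\mathcal{S}$. Moreover, for $w\in\mathcal{S}$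 and $z\in\overline{\mathcal{S}}$, $$S_{\mathcal S}(z,w)=\Big(\frac{\pi}{2d}\Big)^7\csc\Big(\frac{\pi}{2d}(z+\overline{w})\Big),\qquad\text{where}\quad \csc(z)=\sum_{n\in\mathbb{Z}}(-1)^n\frac{\overline{z}+\pi n}{|z+\pi n|^8}$$ is the singly periodic $\mathbb{O}$-regular cosecant, whose series converges unconditionally at these points. -/

import Mathlib

open MeasureTheory Filter Topology

noncomputable section

/-- The octonions, as the Euclidean space `ℝ⁸`: `z = x₀ + x₁ e₁ + ⋯ + x₇ e₇` has coordinates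
`z 0, …, z 7`, and the norm is the Euclidean one. -/
abbrev Octonion : Type := EuclideanSpace ℝ (Fin 8)

namespace Octonion

/-- The unit `e 0 = 1` and the seven imaginary units `e 1, …, e 7`. -/
def e (i : Fin 8) : Octonion := EuclideanSpace.single i 1

/-- Octonionic multiplication: the bilinear product with identity `e 0`, `e i * e i = -e 0` and
`e i * e j = -(e j * e i)` for distinct `i, j ≥ 1`, and
`e₁e₂ = e₄`, `e₁e₃ = e₅`, `e₁e₇ = e₆`, `e₂e₃ = e₆`, `e₂e₅ = e₇`, `e₃e₇ = e₄`, `e₅e₄ = e₆`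
together with the cyclic permutations of these seven products. -/
instance : Mul Octonion where
  mul a b := !₂[
    a 0 * b 0 - a 1 * b 1 - a 2 * b 2 - a 3 * b 3 - a 4 * b 4 - a 5 * b 5 - a 6 * b 6 - a 7 * b 7,
    a 0 * b 1 + a 1 * b 0 + a 2 * b 4 + a 3 * b 5 - a 4 * b 2 - a 5 * b 3 - a 6 * b 7 + a 7 * b 6,
    a 0 * b 2 - a 1 * b 4 + a 2 * b 0 + a 3 * b 6 + a 4 * b 1 + a 5 * b 7 - a 6 * b 3 - a 7 * b 5,
    a 0 * b 3 - a 1 * b 5 - a 2 * b 6 + a 3 * b 0 - a 4 * b 7 + a 5 * b 1 + a 6 * b 2 + a 7 * b 4,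
    a 0 * b 4 + a 1 * b 2 - a 2 * b 1 + a 3 * b 7 + a 4 * b 0 - a 5 * b 6 + a 6 * b 5 - a 7 * b 3,
    a 0 * b 5 + a 1 * b 3 - a 2 * b 7 - a 3 * b 1 + a 4 * b 6 + a 5 * b 0 - a 6 * b 4 + a 7 * b 2,
    a 0 * b 6 + a 1 * b 7 + a 2 * b 3 - a 3 * b 2 - a 4 * b 5 + a 5 * b 4 + a 6 * b 0 - a 7 * b 1,
    a 0 * b 7 - a 1 * b 6 + a 2 * b 5 - a 3 * b 4 + a 4 * b 3 - a 5 * b 2 + a 6 * b 1 + a 7 * b 0]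

/-- Octonionic conjugation. -/
def conj (z : Octonion) : Octonion :=
  !₂[z 0, -z 1, -z 2, -z 3, -z 4, -z 5, -z 6, -z 7]

/-- A real number as an octonion. -/
def ofReal (t : ℝ) : Octonion := t • e 0

/-- `f` is left `𝕆`-regular on the (open) set `U`: it is real differentiable there and
`∂f/∂x₀ + ∑_{i=1}^7 e_i (∂f/∂x_i) = 0`. -/
def LeftRegularOn (f : Octonion → Octonion) (U : Set Octonion) : Prop :=
  ∀ z ∈ U, DifferentiableAt ℝ f z ∧ ∑ i : Fin 8, e i * fderiv ℝ f z (e i) = 0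

/-- The `n`-th term `(-1)ⁿ (z̄ + πn) / |z + πn|⁸` of the cosecant series. -/
def cscTerm (z : Octonion) (n : ℤ) : Octonion :=
  ((-1 : ℝ) ^ n / ‖z + ofReal (Real.pi * n)‖ ^ 8) • (conj z + ofReal (Real.pi * n))

/-- The singly periodic `𝕆`-regular cosecant. -/
def csc (z : Octonion) : Octonion := ∑' n : ℤ, cscTerm z n

/-- The strip `0 < Re z < d`. -/
def strip (d : ℝ) : Set Octonion := {z | 0 < z 0 ∧ z 0 < d}

/-- The isometric parametrization of the hyperplane `Re z = t` by `ℝ⁷`. -/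
def slice (t : ℝ) (x : EuclideanSpace ℝ (Fin 7)) : Octonion :=
  !₂[t, x 0, x 1, x 2, x 3, x 4, x 5, x 6]

/-- The surface measure `dS` of the boundary of the strip, that is, `7`-dimensional Lebesgue
measure on each of the two hyperplanes `Re z = 0` and `Re z = d`. -/
def boundaryMeasure (d : ℝ) : Measure Octonion :=
  (volume : Measure (EuclideanSpace ℝ (Fin 7))).map (slice 0) +
    (volume : Measure (EuclideanSpace ℝ (Fin 7))).map (slice d)

/-- The functions that generate the Hardy space: left `𝕆`-regular in the strip, continuous up to
the boundary, with square integrals over the hyperplanes `Re z = t`, `0 ≤ t ≤ d`, that are finite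
and bounded uniformly in `t`. In particular they are square-integrable over the boundary. -/
def hardyCore (d : ℝ) : Set (Octonion → Octonion) :=
  {f | LeftRegularOn f (strip d) ∧ ContinuousOn f (closure (strip d)) ∧
    ∃ C : NNReal, ∀ t ∈ Set.Icc 0 d,
      ∫⁻ x : EuclideanSpace ℝ (Fin 7), ‖f (slice t x)‖ₑ ^ 2 ≤ C}

/-- The Hardy space of the strip: the closure of `hardyCore d` with respect to the `L²` norm of the
boundary. An element is represented by a function `f` whose values on the boundary are the `L²`
boundary values and whose values in the strip are the limits of the values of the approximating
functions. Values of `f` outside the closed strip play no role. -/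
def hardySpace (d : ℝ) : Set (Octonion → Octonion) :=
  {f | LeftRegularOn f (strip d) ∧ MemLp f 2 (boundaryMeasure d) ∧
    ∃ u : ℕ → Octonion → Octonion, (∀ k, u k ∈ hardyCore d) ∧
      Tendsto (fun k => eLpNorm (u k - f) 2 (boundaryMeasure d)) atTop (𝓝 0) ∧
      ∀ z ∈ strip d, Tendsto (fun k => u k z) atTop (𝓝 (f z))}

/-- The `𝕆`-valued inner product `(f, g) = (3/π⁴) ∫_{∂S} conj(g) f dS`. -/
def hardyInner (d : ℝ) (f g : Octonion → Octonion) : Octonion :=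
  (3 / Real.pi ^ 4) • ∫ z, conj (g z) * f z ∂(boundaryMeasure d)

/-- `K` is a reproducing (Szegő) kernel of the strip: for each `w` in the strip, `K(·, w)` belongs
to the Hardy space and `f(w) = (f, K(·, w))` for every `f` in the Hardy space. -/
def IsSzegoKernel (d : ℝ) (K : Octonion → Octonion → Octonion) : Prop :=
  ∀ w ∈ strip d, (fun z => K z w) ∈ hardySpace d ∧
    ∀ f ∈ hardySpace d, f w = hardyInner d f (fun z => K z w)

/-- The `n`-th term `(-1)ⁿ (z̄ + w + 2dn) / |z̄ + w + 2dn|⁸`. -/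
def szegoTerm (d : ℝ) (z w : Octonion) (n : ℤ) : Octonion :=
  ((-1 : ℝ) ^ n / ‖conj z + w + ofReal (2 * d * n)‖ ^ 8) • (conj z + w + ofReal (2 * d * n))

/-- The alternating series `∑ₙ (-1)ⁿ (z̄ + w + 2dn) / |z̄ + w + 2dn|⁸`. -/
def szegoSeries (d : ℝ) (z w : Octonion) : Octonion := ∑' n : ℤ, szegoTerm d z w n

end Octonion

end

noncomputable section

namespace Octonion

/-! On the hyperplane Re z = t one has z̄ = 2t - z, so the conjugate of the n-th term of the kernel
is, up to sign, a Cauchy kernel q̄/|q|⁸ with pole w + 2dn + 2t (`conj_szegoTerm_slice`). The poles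
coming from Re z = 0 and from Re z = d are therefore the same points w + 2dm, shifted by one index,
and the alternating signs turn the sum of the two boundary integrals into (-1)ᵐ times their
difference, which is the boundary integral of Cauchy's formula. Only m = 0 gives a pole in the
closed strip; its term equals (π⁴/3) f(w) and all others vanish (`integral_conj_szegoSeries_mul`).
The factor 3/π⁴ normalizes this to f(w).

Cauchy's formula must be proved without associativity. The divergence theorem is applied to the
fields G(e_i f), with this bracketing: regularity of f removes one half of the product rule, and for
the Cauchy kernel the identity ā(ab) = |a|²b evaluates the other half. The kernel is regularized to
q̄/(|q|² + ε)⁴, which is smooth and whose divergence 8ε/(|q|² + ε)⁵ is a peak of mass π⁴/3. A cutoff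
at infinity gives the formula for ε > 0 (`integral_cauchyKernel_slice_sub`), and ε → 0 gives the
value at the pole (`integral_cauchyKernel_zero_slice_sub`).

The reproducing property passes from the generating functions to their closure by continuity of the
pairing. If K is another kernel, then g = K(·,w) - S(·,w) satisfies (g,g) = g(w) - g(w) = 0, so g
vanishes almost everywhere on the boundary and, by reproduction, in the strip. -/

/-! ### Octonion algebra -/

lemma ext_coord {a b : Octonion} (h : ∀ i, a i = b i) : a = b := by
  ext i; exact h i

lemma norm_sq_eq_sum (a : Octonion) : ‖a‖ ^ 2 =
    a 0 ^ 2 + a 1 ^ 2 + a 2 ^ 2 + a 3 ^ 2 + a 4 ^ 2 + a 5 ^ 2 + a 6 ^ 2 + a 7 ^ 2 := by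
  rw [EuclideanSpace.real_norm_sq_eq, Fin.sum_univ_eight]

section coordinates
variable (a b : Octonion)

@[simp] lemma mul_coord0 : (a * b) 0 = a 0 * b 0 - a 1 * b 1 - a 2 * b 2 - a 3 * b 3 - a 4 * b 4
    - a 5 * b 5 - a 6 * b 6 - a 7 * b 7 := rfl
@[simp] lemma mul_coord1 : (a * b) 1 = a 0 * b 1 + a 1 * b 0 + a 2 * b 4 + a 3 * b 5 - a 4 * b 2
    - a 5 * b 3 - a 6 * b 7 + a 7 * b 6 := rfl
@[simp] lemma mul_coord2 : (a * b) 2 = a 0 * b 2 - a 1 * b 4 + a 2 * b 0 + a 3 * b 6 + a 4 * b 1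
    + a 5 * b 7 - a 6 * b 3 - a 7 * b 5 := rfl
@[simp] lemma mul_coord3 : (a * b) 3 = a 0 * b 3 - a 1 * b 5 - a 2 * b 6 + a 3 * b 0 - a 4 * b 7
    + a 5 * b 1 + a 6 * b 2 + a 7 * b 4 := rfl
@[simp] lemma mul_coord4 : (a * b) 4 = a 0 * b 4 + a 1 * b 2 - a 2 * b 1 + a 3 * b 7 + a 4 * b 0
    - a 5 * b 6 + a 6 * b 5 - a 7 * b 3 := rfl
@[simp] lemma mul_coord5 : (a * b) 5 = a 0 * b 5 + a 1 * b 3 - a 2 * b 7 - a 3 * b 1 + a 4 * b 6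
    + a 5 * b 0 - a 6 * b 4 + a 7 * b 2 := rfl
@[simp] lemma mul_coord6 : (a * b) 6 = a 0 * b 6 + a 1 * b 7 + a 2 * b 3 - a 3 * b 2 - a 4 * b 5
    + a 5 * b 4 + a 6 * b 0 - a 7 * b 1 := rfl
@[simp] lemma mul_coord7 : (a * b) 7 = a 0 * b 7 - a 1 * b 6 + a 2 * b 5 - a 3 * b 4 + a 4 * b 3
    - a 5 * b 2 + a 6 * b 1 + a 7 * b 0 := rfl

@[simp] lemma conj_coord0 : conj a 0 = a 0 := rfl
@[simp] lemma conj_coord1 : conj a 1 = -a 1 := rfl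
@[simp] lemma conj_coord2 : conj a 2 = -a 2 := rfl
@[simp] lemma conj_coord3 : conj a 3 = -a 3 := rfl
@[simp] lemma conj_coord4 : conj a 4 = -a 4 := rfl
@[simp] lemma conj_coord5 : conj a 5 = -a 5 := rfl
@[simp] lemma conj_coord6 : conj a 6 = -a 6 := rfl
@[simp] lemma conj_coord7 : conj a 7 = -a 7 := rfl

lemma e_coord (i j : Fin 8) : e i j = if j = i then 1 else 0 := by
  simp [e]

end coordinates

/-- Octonionic multiplication as a bilinear map. -/
def mulLin : Octonion →ₗ[ℝ] Octonion →ₗ[ℝ] Octonion :=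
  LinearMap.mk₂ ℝ (fun a b => a * b)
    (fun a b c => by apply ext_coord; intro i; fin_cases i <;> simp <;> ring)
    (fun r a b => by apply ext_coord; intro i; fin_cases i <;> simp <;> ring)
    (fun a b c => by apply ext_coord; intro i; fin_cases i <;> simp <;> ring)
    (fun r a b => by apply ext_coord; intro i; fin_cases i <;> simp <;> ring)

/-- This is Degen's eight-square identity, a polynomial identity in the coordinates. -/
lemma norm_mul_oct (a b : Octonion) : ‖a * b‖ = ‖a‖ * ‖b‖ := by
  rw [← sq_eq_sq₀ (norm_nonneg _) (by positivity), mul_pow, norm_sq_eq_sum, norm_sq_eq_sum,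
    norm_sq_eq_sum]
  simp only [mul_coord0, mul_coord1, mul_coord2, mul_coord3, mul_coord4, mul_coord5, mul_coord6,
    mul_coord7]
  ring

/-- Octonionic multiplication as a continuous bilinear map. -/
def mulL : Octonion →L[ℝ] Octonion →L[ℝ] Octonion :=
  mulLin.mkContinuous₂ 1 fun a b => by
    rw [one_mul]; exact (norm_mul_oct a b).le

lemma mulL_apply (a b : Octonion) : mulL a b = a * b := rfl

lemma add_mul_oct (a b c : Octonion) : (a + b) * c = a * c + b * c := mulLin.map_add₂ a b c
lemma mul_add_oct (a b c : Octonion) : a * (b + c) = a * b + a * c := (mulLin a).map_add b c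
lemma mul_sub_oct (a b c : Octonion) : a * (b - c) = a * b - a * c := (mulLin a).map_sub b c
lemma sub_mul_oct (a b c : Octonion) : (a - b) * c = a * c - b * c := mulLin.map_sub₂ a b c
lemma smul_mul_oct (r : ℝ) (a b : Octonion) : (r • a) * b = r • (a * b) := mulLin.map_smul₂ r a b
lemma mul_smul_oct (r : ℝ) (a b : Octonion) : a * (r • b) = r • (a * b) := (mulLin a).map_smul r b
lemma neg_mul_oct (a b : Octonion) : (-a) * b = -(a * b) := mulLin.map_neg₂ a b
lemma mul_zero_oct (a : Octonion) : a * 0 = 0 := (mulLin a).map_zero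
lemma zero_mul_oct (a : Octonion) : (0 : Octonion) * a = 0 := mulLin.map_zero₂ a
lemma mul_sum_oct {ι : Type*} (s : Finset ι) (a : Octonion) (f : ι → Octonion) :
    a * ∑ i ∈ s, f i = ∑ i ∈ s, a * f i := map_sum (mulLin a) f s

/-- Octonionic conjugation as a linear isometry. -/
def conjLI : Octonion →ₗᵢ[ℝ] Octonion where
  toFun := conj
  map_add' a b := by apply ext_coord; intro i; fin_cases i <;> simp <;> ring
  map_smul' r a := by apply ext_coord; intro i; fin_cases i <;> simp
  norm_map' a := by
    change ‖conj a‖ = ‖a‖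
    rw [← sq_eq_sq₀ (norm_nonneg _) (norm_nonneg _), norm_sq_eq_sum, norm_sq_eq_sum]
    simp

lemma norm_conj (a : Octonion) : ‖conj a‖ = ‖a‖ := conjLI.norm_map a
lemma conj_add (a b : Octonion) : conj (a + b) = conj a + conj b := conjLI.map_add a b
lemma conj_sub (a b : Octonion) : conj (a - b) = conj a - conj b := conjLI.map_sub a b
lemma conj_neg (a : Octonion) : conj (-a) = -conj a := conjLI.map_neg a
lemma conj_smul (r : ℝ) (a : Octonion) : conj (r • a) = r • conj a := conjLI.map_smul r a
lemma continuous_conj : Continuous conj := conjLI.continuous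
lemma conj_conj (a : Octonion) : conj (conj a) = a := by
  apply ext_coord; intro i; fin_cases i <;> simp

lemma conj_ofReal (t : ℝ) : conj (ofReal t) = ofReal t := by
  apply ext_coord; intro i; fin_cases i <;> simp [ofReal, e_coord]

lemma ofReal_add (s t : ℝ) : ofReal (s + t) = ofReal s + ofReal t := add_smul _ _ _

lemma smul_ofReal (s t : ℝ) : s • ofReal t = ofReal (s * t) := smul_smul _ _ _

lemma ofReal_coord0 (t : ℝ) : ofReal t 0 = t := by simp [ofReal, e_coord]

lemma one_mul_oct (a : Octonion) : e 0 * a = a := by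
  apply ext_coord; intro i; fin_cases i <;> simp [e_coord]

/-- This consequence of alternativity is the substitute for associativity in Cauchy's formula. -/
lemma conj_mul_mul (a b : Octonion) : conj a * (a * b) = ‖a‖ ^ 2 • b := by
  rw [norm_sq_eq_sum]
  apply ext_coord; intro i; fin_cases i <;> simp <;> ring

lemma mul_conj_self (a : Octonion) : a * conj a = ofReal (‖a‖ ^ 2) := by
  rw [norm_sq_eq_sum]
  apply ext_coord; intro i; fin_cases i <;> simp [ofReal, e_coord] <;> ring

lemma conj_mul_self (a : Octonion) : conj a * a = ofReal (‖a‖ ^ 2) := by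
  simpa [conj_conj, norm_conj] using mul_conj_self (conj a)

lemma norm_e (i : Fin 8) : ‖e i‖ = 1 := by simp [e]

lemma sum_smul_e (a : Octonion) : ∑ i, a i • e i = a := by
  apply ext_coord; intro i; simp [e_coord]

lemma inner_e (a : Octonion) (i : Fin 8) : inner ℝ a (e i) = a i := by
  simp [e, EuclideanSpace.inner_single_right]

lemma sum_conj_e_mul (a : Octonion) : ∑ i, conj (e i) * (e i * a) = (8 : ℝ) • a := by
  simp [conj_mul_mul, norm_e, ← Nat.cast_smul_eq_nsmul ℝ]

lemma sum_e_mul_conj_e : ∑ i, e i * conj (e i) = ofReal 8 := by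
  simp [mul_conj_self, norm_e, ← Nat.cast_smul_eq_nsmul ℝ, smul_ofReal]

lemma abs_coord_le (a : Octonion) (i : Fin 8) : |a i| ≤ ‖a‖ := by
  simpa using PiLp.norm_apply_le a i

/-! ### The Cauchy kernel and its regularization -/

/-- The regularized Cauchy kernel `q̄ / (|q|² + ε)⁴`; for `ε = 0` it is the Cauchy kernel. -/
def cauchyKernel (ε : ℝ) (q : Octonion) : Octonion := ((‖q‖ ^ 2 + ε) ^ 4)⁻¹ • conj q

/-- The derivative of the regularized Cauchy kernel. -/
def cauchyKernelDeriv (ε : ℝ) (q : Octonion) : Octonion →L[ℝ] Octonion :=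
  ((‖q‖ ^ 2 + ε) ^ 4)⁻¹ • conjLI.toContinuousLinearMap +
    ((-8 * ((‖q‖ ^ 2 + ε) ^ 5)⁻¹) • innerSL ℝ q).smulRight (conj q)

lemma cauchyKernelDeriv_apply (ε : ℝ) (q v : Octonion) : cauchyKernelDeriv ε q v =
    ((‖q‖ ^ 2 + ε) ^ 4)⁻¹ • conj v +
      (-8 * ((‖q‖ ^ 2 + ε) ^ 5)⁻¹ * inner ℝ q v) • conj q := rfl

lemma hasFDerivAt_cauchyKernel {ε : ℝ} {q : Octonion} (h : 0 < ‖q‖ ^ 2 + ε) :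
    HasFDerivAt (cauchyKernel ε) (cauchyKernelDeriv ε q) q := by
  have h1 : HasFDerivAt (fun q : Octonion => ‖q‖ ^ 2 + ε) (2 • innerSL ℝ q) q :=
    ((hasStrictFDerivAt_norm_sq q).hasFDerivAt).add_const ε
  have h2 : HasDerivAt (fun s : ℝ => (s ^ 4)⁻¹) (-4 * ((‖q‖ ^ 2 + ε) ^ 5)⁻¹) (‖q‖ ^ 2 + ε) := by
    convert! (hasDerivAt_pow 4 (‖q‖ ^ 2 + ε)).inv (by positivity) using 1
    field_simp
    norm_num
  have h3 := (h2.comp_hasFDerivAt q h1).smul conjLI.toContinuousLinearMap.hasFDerivAt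
  convert! h3 using 1
  ext1 v
  rw [cauchyKernelDeriv_apply]
  simp only [Function.comp_apply, add_apply, smul_apply,
    ContinuousLinearMap.smulRight_apply, innerSL_apply_apply, smul_eq_mul, nsmul_eq_mul]
  change _ = _ • conj v + _ • conj q
  congr 2
  simp
  ring

/-- Differentiating q̄ contributes 8(|q|² + ε)⁻⁴, and differentiating the denominator contributes
-8|q|²(|q|² + ε)⁻⁵, because the sum of q_i q̄(e_i a) is q̄(qa) = |q|²a. The difference is the peak
that will reproduce values of f. -/
lemma sum_cauchyKernelDeriv_mul {ε : ℝ} {q : Octonion} (h : 0 < ‖q‖ ^ 2 + ε) (a : Octonion) :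
    ∑ i, cauchyKernelDeriv ε q (e i) * (e i * a) = (8 * ε * ((‖q‖ ^ 2 + ε) ^ 5)⁻¹) • a := by
  have h1 : ∑ i, q i • (conj q * (e i * a)) = ‖q‖ ^ 2 • a := by
    rw [← conj_mul_mul, ← sum_smul_e q]
    conv_rhs => rw [← mulL_apply, ← mulL_apply, map_sum]
    simp [sum_smul_e, mulL_apply]
  simp only [cauchyKernelDeriv_apply, add_mul_oct, smul_mul_oct, Finset.sum_add_distrib,
    ← Finset.smul_sum, sum_conj_e_mul, inner_e, mul_smul, h1]
  simp only [smul_smul, ← add_smul]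
  congr 1
  field_simp
  ring

/-- Left regularity of the Cauchy kernel, needed for membership of the series in the Hardy space;
the preceding lemma is the right-hand counterpart used in Cauchy's formula. -/
lemma sum_mul_cauchyKernelDeriv {q : Octonion} (h : q ≠ 0) :
    ∑ i, e i * cauchyKernelDeriv 0 q (e i) = 0 := by
  have h1 : ∑ i, q i • (e i * conj q) = ofReal (‖q‖ ^ 2) := by
    rw [← mul_conj_self]
    conv_rhs => rw [← mulL_apply]; enter [1]; rw [← sum_smul_e q]
    simp [mulL_apply, map_sum]
  have h0 : ‖q‖ ≠ 0 := norm_ne_zero_iff.2 h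
  simp only [cauchyKernelDeriv_apply, mul_add_oct, mul_smul_oct, Finset.sum_add_distrib,
    ← Finset.smul_sum, sum_e_mul_conj_e, inner_e, mul_smul, h1]
  rw [smul_ofReal, smul_ofReal, smul_ofReal, ← ofReal_add]
  convert zero_smul ℝ (e 0) using 1
  rw [ofReal]
  congr 1
  field_simp
  ring

lemma norm_cauchyKernelDeriv_zero_le {q : Octonion} (h : q ≠ 0) :
    ‖cauchyKernelDeriv 0 q‖ ≤ 9 * (‖q‖ ^ 8)⁻¹ := by
  have h0 : 0 < ‖q‖ := norm_pos_iff.2 h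
  refine ContinuousLinearMap.opNorm_le_bound _ (by positivity) fun v => ?_
  rw [cauchyKernelDeriv_apply]
  refine (norm_add_le _ _).trans ?_
  rw [norm_smul, norm_smul, norm_conj, norm_conj, norm_mul]
  have h1 := norm_inner_le_norm (𝕜 := ℝ) q v
  have h2 : ‖-8 * ((‖q‖ ^ 2 + 0) ^ 5)⁻¹‖ = 8 * ((‖q‖ ^ 2) ^ 5)⁻¹ := by
    rw [norm_mul, add_zero, Real.norm_of_nonneg (by positivity : (0:ℝ) ≤ ((‖q‖ ^ 2) ^ 5)⁻¹)]
    norm_num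
  have h3 : ‖((‖q‖ ^ 2 + 0) ^ 4)⁻¹‖ = (‖q‖ ^ 8)⁻¹ := by
    rw [Real.norm_of_nonneg (by positivity), add_zero, ← pow_mul]
  rw [h2, h3]
  calc _ ≤ (‖q‖ ^ 8)⁻¹ * ‖v‖ + 8 * ((‖q‖ ^ 2) ^ 5)⁻¹ * (‖q‖ * ‖v‖) * ‖q‖ := by gcongr
    _ = _ := by field_simp; ring

lemma norm_cauchyKernel_zero (q : Octonion) : ‖cauchyKernel 0 q‖ = (‖q‖ ^ 7)⁻¹ := by
  rcases eq_or_ne q 0 with rfl | h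
  · simp [cauchyKernel]
  have h0 : 0 < ‖q‖ := norm_pos_iff.2 h
  rw [cauchyKernel, norm_smul, norm_conj, add_zero, Real.norm_of_nonneg (by positivity)]
  field_simp

/-- `L²`-type bound for the regularized kernel. -/
lemma norm_cauchyKernel_sq_le {ε c : ℝ} {q : Octonion} (hε : 0 ≤ ε) (hc : 0 < c)
    (h : c * (1 + ‖q‖ ^ 2) ≤ ‖q‖ ^ 2 + ε) :
    ‖cauchyKernel ε q‖ ^ 2 ≤ (c ^ 7)⁻¹ * ((1 + ‖q‖ ^ 2) ^ 7)⁻¹ := by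
  have h0 : 0 < ‖q‖ ^ 2 + ε := lt_of_lt_of_le (by positivity) h
  rw [cauchyKernel, norm_smul, norm_conj, Real.norm_of_nonneg (by positivity), mul_pow]
  calc _ ≤ (((‖q‖ ^ 2 + ε) ^ 4)⁻¹) ^ 2 * (‖q‖ ^ 2 + ε) :=
        mul_le_mul_of_nonneg_left (by linarith) (by positivity)
    _ = ((‖q‖ ^ 2 + ε) ^ 7)⁻¹ := by field_simp
    _ ≤ ((c * (1 + ‖q‖ ^ 2)) ^ 7)⁻¹ := by gcongr
    _ = _ := by rw [mul_pow, mul_inv]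

lemma contDiff_cauchyKernel {ε : ℝ} (hε : 0 < ε) : ContDiff ℝ 1 (cauchyKernel ε) := by
  unfold cauchyKernel
  have h : ContDiff ℝ 1 fun q : Octonion => (‖q‖ ^ 2 + ε) ^ 4 :=
    ((contDiff_norm_sq ℝ).add contDiff_const).pow 4
  exact (h.inv fun q => by positivity).smul conjLI.contDiff

lemma tendsto_cauchyKernel {q : Octonion} (h : q ≠ 0) :
    Tendsto (fun ε => cauchyKernel ε q) (𝓝 0) (𝓝 (cauchyKernel 0 q)) := by
  have h0 : 0 < ‖q‖ := norm_pos_iff.2 h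
  have : ContinuousAt (fun ε => cauchyKernel ε q) 0 := by
    unfold cauchyKernel
    have h1 : ContinuousAt (fun ε : ℝ => (‖q‖ ^ 2 + ε) ^ 4) 0 := by fun_prop
    exact (h1.inv₀ (by positivity)).smul continuousAt_const
  exact this

/-! ### Slicing the octonions by hyperplanes Re z = t -/

/-- The standard isometry splitting, as an equivalence that preserves volume. -/
def sliceEquiv : ℝ × EuclideanSpace ℝ (Fin 7) ≃ᵐ Octonion :=
  ((MeasurableEquiv.refl ℝ).prodCongr (MeasurableEquiv.toLp 2 (Fin 7 → ℝ)).symm).trans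
    ((MeasurableEquiv.piFinSuccAbove (fun _ : Fin 8 => ℝ) 0).symm.trans
      (MeasurableEquiv.toLp 2 (Fin 8 → ℝ)))

lemma slice_eq (t : ℝ) (x : EuclideanSpace ℝ (Fin 7)) :
    slice t x = WithLp.toLp 2 (Fin.cons t x.ofLp : Fin 8 → ℝ) := by
  apply ext_coord; intro i
  fin_cases i <;> rfl

lemma sliceEquiv_apply (p : ℝ × EuclideanSpace ℝ (Fin 7)) : sliceEquiv p = slice p.1 p.2 := by
  rw [slice_eq]
  apply ext_coord; intro i
  fin_cases i <;> rfl

lemma measurePreserving_sliceEquiv : MeasurePreserving sliceEquiv := by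
  refine ((MeasurePreserving.id volume).prod (PiLp.volume_preserving_ofLp (Fin 7))).trans
    ((volume_preserving_piFinSuccAbove (fun _ : Fin 8 => ℝ) 0).symm.trans
      (PiLp.volume_preserving_toLp (Fin 8)))

@[simp] lemma slice_coord0 (t : ℝ) (x : EuclideanSpace ℝ (Fin 7)) : slice t x 0 = t := rfl
lemma slice_coord_succ (t : ℝ) (x : EuclideanSpace ℝ (Fin 7)) (i : Fin 7) :
    slice t x i.succ = x i := by fin_cases i <;> rfl

lemma norm_slice_sq (t : ℝ) (x : EuclideanSpace ℝ (Fin 7)) :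
    ‖slice t x‖ ^ 2 = t ^ 2 + ‖x‖ ^ 2 := by
  rw [EuclideanSpace.real_norm_sq_eq, EuclideanSpace.real_norm_sq_eq, Fin.sum_univ_succ]
  simp [slice_coord_succ]

lemma continuous_slice_uncurry : Continuous fun p : ℝ × EuclideanSpace ℝ (Fin 7) =>
    slice p.1 p.2 := by
  simp only [slice_eq]
  refine (PiLp.continuous_toLp 2 _).comp (continuous_pi fun i => ?_)
  refine Fin.cases ?_ (fun j => ?_) i
  · exact continuous_fst
  · simp only [Fin.cons_succ]; fun_prop

lemma continuous_slice (t : ℝ) : Continuous (slice t) :=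
  continuous_slice_uncurry.comp (Continuous.prodMk_right t)

lemma slice_sub (s t : ℝ) (x y : EuclideanSpace ℝ (Fin 7)) :
    slice s x - slice t y = slice (s - t) (x - y) := by
  apply ext_coord; intro i
  refine Fin.cases ?_ (fun j => ?_) i
  · simp
  · simp [slice_coord_succ]

lemma injective_slice (t : ℝ) : Function.Injective (slice t) := by
  intro x y h
  ext i
  rw [← slice_coord_succ t, h, slice_coord_succ]

lemma measurableEmbedding_slice (t : ℝ) : MeasurableEmbedding (slice t) :=
  (continuous_slice t).measurableEmbedding (injective_slice t)

lemma exists_eq_slice (a : Octonion) : ∃ x, a = slice (a 0) x :=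
  ⟨WithLp.toLp 2 fun i => a i.succ, by
    apply ext_coord; intro i
    refine Fin.cases rfl (fun j => ?_) i
    rw [slice_coord_succ]⟩

lemma closure_strip {d : ℝ} (hd : 0 < d) : closure (strip d) = {z | 0 ≤ z 0 ∧ z 0 ≤ d} := by
  have hopen : IsOpenMap (EuclideanSpace.proj 0 : Octonion →L[ℝ] ℝ) := by
    refine ContinuousLinearMap.isOpenMap _ fun t => ⟨ofReal t, ?_⟩
    simp [ofReal_coord0]
  have h := hopen.preimage_closure_eq_closure_preimage
    (EuclideanSpace.proj 0 : Octonion →L[ℝ] ℝ).continuous (Set.Ioo 0 d)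
  rw [closure_Ioo hd.ne] at h
  exact h.symm

lemma isOpen_strip (d : ℝ) : IsOpen (strip d) :=
  (isOpen_Ioo (a := (0 : ℝ)) (b := d)).preimage
    (EuclideanSpace.proj 0 : Octonion →L[ℝ] ℝ).continuous

instance : ContinuousMul Octonion := ⟨mulL.continuous₂⟩

/-! ### The divergence theorem -/

/-- The divergence theorem in the strip for the product of a compactly supported function with a
left regular one. -/
theorem integral_slice_sub_integral_slice {d : ℝ} (hd : 0 < d) {f G : Octonion → Octonion}
    (hf : LeftRegularOn f (strip d)) (hfc : ContinuousOn f (closure (strip d)))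
    (hG : ContDiff ℝ 1 G) (hGs : HasCompactSupport G) :
    (∫ x, G (slice d x) * f (slice d x)) - ∫ x, G (slice 0 x) * f (slice 0 x) =
      ∫ z in closure (strip d), ∑ i, fderiv ℝ G z (e i) * (e i * f z) := by
  obtain ⟨R, hR0, hR⟩ : ∃ R > 0, ∀ z ∈ tsupport G, ‖z‖ < R := by
    obtain ⟨R, hR⟩ := hGs.isCompact.isBounded.exists_norm_le
    exact ⟨max R 0 + 1, by positivity, fun z hz => by
      have := hR z hz
      have := le_max_left R 0
      linarith⟩
  have hG0 : ∀ z : Octonion, R ≤ ‖z‖ → z ∉ tsupport G := fun z hz h => (hR z h).not_ge hz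
  have hGz : ∀ z : Octonion, R ≤ ‖z‖ → G z = 0 := fun z hz =>
    image_eq_zero_of_notMem_tsupport (hG0 z hz)
  have hGd : ∀ z : Octonion, R ≤ ‖z‖ → fderiv ℝ G z = 0 := fun z hz =>
    image_eq_zero_of_notMem_tsupport fun h => hG0 z hz (tsupport_fderiv_subset ℝ h)
  let L : (Fin 8 → ℝ) ≃L[ℝ] Octonion := (EuclideanSpace.equiv (Fin 8) ℝ).symm
  have hLe : ∀ i, L (Pi.single i 1) = e i := fun i => rfl
  have hLv : MeasurePreserving L := PiLp.volume_preserving_toLp (Fin 8)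
  have hLm : MeasurableEmbedding L := L.toHomeomorph.measurableEmbedding
  classical
  -- Setting the derivative to zero off the open strip makes the regularity equation, and so the
  -- divergence identity, hold at every point.
  let f' : Octonion → Octonion →L[ℝ] Octonion := fun z => if z ∈ strip d then fderiv ℝ f z else 0
  have hf' : ∀ z, ∑ i, e i * f' z (e i) = 0 := by
    intro z
    by_cases hz : z ∈ strip d
    · simp only [f', if_pos hz]; exact (hf z hz).2
    · simp [f', if_neg hz, mul_zero_oct]
  let P : Fin 8 → Octonion → Octonion →L[ℝ] Octonion := fun i z =>
    mulL.precompR _ (G z) ((mulL (e i)).comp (f' z)) + mulL.precompL _ (fderiv ℝ G z) (e i * f z)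
  have hP : ∀ i z, z ∈ strip d → HasFDerivAt (fun z => G z * (e i * f z)) (P i z) z := by
    intro i z hz
    have h1 : HasFDerivAt f (f' z) z := by
      simp only [f', if_pos hz]; exact (hf z hz).1.hasFDerivAt
    have h2 := (mulL (e i)).hasFDerivAt.comp z h1
    exact mulL.hasFDerivAt_of_bilinear ((hG.differentiable one_ne_zero) z).hasFDerivAt h2
  have hPv : ∀ i z v, P i z v = G z * (e i * f' z v) + fderiv ℝ G z v * (e i * f z) :=
    fun i z v => rfl
  -- With the bracketing G(e_i f), the terms that differentiate f collect to G times the regularity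
  -- equation and drop out.
  have hdiv : ∀ z, ∑ i, P i z (e i) = ∑ i, fderiv ℝ G z (e i) * (e i * f z) := by
    intro z
    simp only [hPv, Finset.sum_add_distrib]
    rw [← mul_sum_oct, hf', mul_zero_oct, zero_add]
  -- The box is [0, d] × [-R, R]⁷: its lateral faces miss the support of G, so only the two faces on
  -- the boundary of the strip contribute.
  let a : Fin 8 → ℝ := Fin.cons 0 fun _ => -R
  let b : Fin 8 → ℝ := Fin.cons d fun _ => R
  have hab : a ≤ b := by
    intro i
    refine Fin.cases ?_ (fun j => ?_) i
    · simpa [a, b] using hd.le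
    · simp only [a, b, Fin.cons_succ]; linarith
  have hbox : ∀ y ∈ Set.Icc a b, L y ∈ closure (strip d) := by
    intro y hy
    rw [closure_strip hd]
    exact ⟨hy.1 0, hy.2 0⟩
  have hfL : ContinuousOn (fun y => f (L y)) (Set.Icc a b) :=
    hfc.comp L.continuous.continuousOn hbox
  have hefL : ∀ i, ContinuousOn (fun y => e i * f (L y)) (Set.Icc a b) := fun i =>
    continuousOn_const.mul hfL
  have hGL : Continuous fun y => G (L y) := hG.continuous.comp L.continuous
  have hcont : ∀ i, ContinuousOn (fun y => G (L y) * (e i * f (L y))) (Set.Icc a b) := fun i =>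
    hGL.continuousOn.mul (hefL i)
  have hdGL : ∀ i, Continuous fun y => fderiv ℝ G (L y) (e i) := fun i =>
    ((hG.continuous_fderiv one_ne_zero).comp L.continuous).clm_apply continuous_const
  have hdcont : ContinuousOn (fun y => ∑ i, fderiv ℝ G (L y) (e i) * (e i * f (L y)))
      (Set.Icc a b) :=
    continuousOn_finsetSum _ fun i _ => (hdGL i).continuousOn.mul (hefL i)
  have key := integral_divergence_of_hasFDerivAt_off_countable' a b hab
    (fun i y => G (L y) * (e i * f (L y)))
    (fun i y => (P i (L y)).comp (L : (Fin 8 → ℝ) →L[ℝ] Octonion)) ∅ Set.countable_empty hcont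
    (fun y hy i => by
      refine (hP i (L y) ?_).comp y L.hasFDerivAt
      have := hy.1 0 (Set.mem_univ _)
      exact ⟨this.1, this.2⟩)
    (by
      simp only [ContinuousLinearMap.comp_apply, ContinuousLinearEquiv.coe_coe, hLe, hdiv]
      exact hdcont.integrableOn_Icc)
  simp only [ContinuousLinearMap.comp_apply, ContinuousLinearEquiv.coe_coe, hLe, hdiv] at key
  have hcoord : ∀ (y : Fin 8 → ℝ) (i : Fin 8), |y i| ≤ ‖L y‖ := fun y i => abs_coord_le (L y) i
  have hlat : ∀ (i : Fin 7) (c : ℝ) (x : Fin 7 → ℝ), |c| = R →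
      G (L (i.succ.insertNth (α := fun _ => ℝ) c x)) = 0 := by
    intro i c x hc
    refine hGz _ ?_
    have := hcoord (i.succ.insertNth (α := fun _ => ℝ) c x) i.succ
    rwa [Fin.insertNth_apply_same, hc] at this
  have hface : ∀ c : ℝ, (∫ x in Set.Icc (a ∘ Fin.succAbove 0) (b ∘ Fin.succAbove 0),
      G (L (Fin.insertNth (α := fun _ => ℝ) 0 c x)) *
        (e 0 * f (L (Fin.insertNth (α := fun _ => ℝ) 0 c x)))) =
      ∫ x, G (slice c x) * f (slice c x) := by
    intro c
    have h1 : ∀ x : Fin 7 → ℝ, L (Fin.insertNth (α := fun _ => ℝ) 0 c x) =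
        slice c (WithLp.toLp 2 x) := by
      intro x
      rw [slice_eq, Fin.insertNth_zero']
      rfl
    simp only [h1, one_mul_oct]
    rw [setIntegral_eq_integral_of_forall_compl_eq_zero]
    · exact (PiLp.volume_preserving_toLp (Fin 7)).integral_comp
        (MeasurableEquiv.toLp 2 (Fin 7 → ℝ)).measurableEmbedding
        fun x => G (slice c x) * f (slice c x)
    · intro x hx
      rw [hGz, zero_mul_oct]
      by_contra! hlt
      refine hx ⟨fun j => ?_, fun j => ?_⟩
      all_goals
        have := (abs_coord_le (slice c (WithLp.toLp 2 x)) j.succ).trans hlt.le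
        rw [slice_coord_succ] at this
        simp only [a, b, Function.comp_apply, Fin.zero_succAbove, Fin.cons_succ]
      · exact (abs_le.1 this).1
      · exact (abs_le.1 this).2
  rw [Fin.sum_univ_succ, Finset.sum_eq_zero (fun i _ => ?_), add_zero, hface, hface] at key
  · change _ = (∫ x, G (slice d x) * f (slice d x)) - ∫ x, G (slice 0 x) * f (slice 0 x) at key
    rw [← key, ← hLv.setIntegral_preimage_emb hLm (fun z =>
      ∑ i, fderiv ℝ G z (e i) * (e i * f z))]
    refine (setIntegral_eq_of_subset_of_forall_sdiff_eq_zero ?_ hbox ?_).symm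
    · exact (isClosed_closure.preimage L.continuous).measurableSet
    · intro y hy
      refine Finset.sum_eq_zero fun i _ => ?_
      rw [hGd, zero_apply, zero_mul_oct]
      by_contra! hlt
      refine hy.2 ?_
      have h1 := hy.1
      rw [closure_strip hd] at h1
      have h2 : ∀ j : Fin 7, |y j.succ| ≤ R := fun j => (hcoord y j.succ).trans hlt.le
      exact ⟨fun j => Fin.cases h1.1 (fun j => (abs_le.1 (h2 j)).1) j,
        fun j => Fin.cases h1.2 (fun j => (abs_le.1 (h2 j)).2) j⟩
  · have hb : |b i.succ| = R := by simp [b, abs_of_pos hR0]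
    have ha : |a i.succ| = R := by simp [a, abs_of_pos hR0]
    simp only [hlat i _ _ hb, hlat i _ _ ha, zero_mul_oct, integral_zero, sub_self]

/-! ### Integrable bounds for domination -/

/-- The weight `8ε / (|q|² + ε)⁵`, the divergence of the regularized Cauchy kernel. -/
def peakWeight (ε : ℝ) (q : Octonion) : ℝ := 8 * ε * ((‖q‖ ^ 2 + ε) ^ 5)⁻¹

lemma peakWeight_nonneg {ε : ℝ} (hε : 0 ≤ ε) (q : Octonion) : 0 ≤ peakWeight ε q := by
  unfold peakWeight; positivity

/-- The natural decay has exponent 10; it is weakened to 7 so that one weight dominates both the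
peak and the kernel. -/
lemma peakWeight_sq_le {ε c : ℝ} {q : Octonion} (hε : 0 ≤ ε) (hε1 : ε ≤ 1) (hc : 0 < c)
    (h : c * (1 + ‖q‖ ^ 2) ≤ ‖q‖ ^ 2 + ε) :
    peakWeight ε q ^ 2 ≤ 64 * (c ^ 10)⁻¹ * ((1 + ‖q‖ ^ 2) ^ 7)⁻¹ := by
  have h0 : 0 < ‖q‖ ^ 2 + ε := lt_of_lt_of_le (by positivity) h
  have h1 : 1 ≤ 1 + ‖q‖ ^ 2 := by nlinarith [norm_nonneg q]
  calc peakWeight ε q ^ 2 = 64 * ε ^ 2 * ((‖q‖ ^ 2 + ε) ^ 10)⁻¹ := by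
        unfold peakWeight; field_simp; ring
    _ ≤ 64 * 1 ^ 2 * ((c * (1 + ‖q‖ ^ 2)) ^ 10)⁻¹ := by gcongr
    _ = 64 * (c ^ 10)⁻¹ * ((1 + ‖q‖ ^ 2) ^ 10)⁻¹ := by rw [mul_pow, mul_inv]; ring
    _ ≤ _ := by gcongr; norm_num

section integrability

variable {E : Type*} [NormedAddCommGroup E] [NormedSpace ℝ E] [FiniteDimensional ℝ E]
  [MeasurableSpace E] [BorelSpace E] {μ : Measure E} [μ.IsAddHaarMeasure]

lemma integrable_inv_one_add_norm_sq_pow {k : ℕ} (hk : Module.finrank ℝ E < 2 * k) (a : E) :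
    Integrable (fun x : E => ((1 + ‖x - a‖ ^ 2) ^ k)⁻¹) μ := by
  have h : Integrable (fun x : E => ((1 + ‖x‖ ^ 2) ^ k)⁻¹) μ := by
    convert! integrable_rpow_neg_one_add_norm_sq (E := E) (μ := μ) (r := 2 * k)
      (by exact_mod_cast hk) using 2 with x
    rw [neg_div, mul_div_cancel_left₀ _ (two_ne_zero' ℝ), Real.rpow_neg (by positivity),
      Real.rpow_natCast]
  exact h.comp_sub_right a

end integrability

/-- Dropping the real coordinate of the difference leaves a translate of a function on ℝ⁷ that
decays with order 14 > 7. -/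
lemma integrable_slice_weight (t : ℝ) (a : Octonion) :
    Integrable fun x => ((1 + ‖slice t x - a‖ ^ 2) ^ 7)⁻¹ := by
  obtain ⟨y, hy⟩ := exists_eq_slice a
  refine (integrable_inv_one_add_norm_sq_pow (k := 7) (by simp) y).mono' ?_
    (Eventually.of_forall fun x => ?_)
  · have := continuous_slice t
    exact (Continuous.inv₀ (by fun_prop) fun x => by positivity).aestronglyMeasurable
  · rw [Real.norm_of_nonneg (by positivity), hy, slice_sub, norm_slice_sq]
    gcongr
    nlinarith [sq_nonneg (t - a 0)]

lemma integrable_weight (a : Octonion) :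
    Integrable fun z : Octonion => ((1 + ‖z - a‖ ^ 2) ^ 7)⁻¹ :=
  integrable_inv_one_add_norm_sq_pow (by simp) a

section core

variable {d : ℝ} {f : Octonion → Octonion}

lemma slice_mem_closure_strip (hd : 0 < d) {t : ℝ} (ht : t ∈ Set.Icc 0 d)
    (x : EuclideanSpace ℝ (Fin 7)) : slice t x ∈ closure (strip d) := by
  rw [closure_strip hd]; exact ht

lemma continuous_comp_slice (hd : 0 < d) (hfc : ContinuousOn f (closure (strip d))) {t : ℝ}
    (ht : t ∈ Set.Icc 0 d) : Continuous fun x => f (slice t x) :=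
  hfc.comp_continuous (continuous_slice t) fun x => slice_mem_closure_strip hd ht x

lemma integrable_norm_sq_of_lintegral {X : Type*} [MeasurableSpace X] {μ : Measure X}
    {g : X → Octonion} (hg : AEStronglyMeasurable g μ) (h : ∫⁻ x, ‖g x‖ₑ ^ 2 ∂μ < ⊤) :
    Integrable (fun x => ‖g x‖ ^ 2) μ := by
  refine ⟨hg.norm.pow 2, ?_⟩
  simpa [HasFiniteIntegral] using h

lemma integrable_norm_sq_slice (hd : 0 < d) (hf : f ∈ hardyCore d) {t : ℝ}
    (ht : t ∈ Set.Icc 0 d) : Integrable fun x => ‖f (slice t x)‖ ^ 2 := by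
  obtain ⟨C, hC⟩ := hf.2.2
  exact integrable_norm_sq_of_lintegral
    (continuous_comp_slice hd hf.2.1 ht).aestronglyMeasurable
    ((hC t ht).trans_lt ENNReal.coe_lt_top)

lemma measurableSet_closure_strip : MeasurableSet (closure (strip d)) :=
  isClosed_closure.measurableSet

/-- By Tonelli, the uniform bound on the slices integrates over t in [0, d] to a finite quantity. -/
lemma integrableOn_norm_sq (hd : 0 < d) (hf : f ∈ hardyCore d) :
    IntegrableOn (fun z => ‖f z‖ ^ 2) (closure (strip d)) := by
  obtain ⟨C, hC⟩ := hf.2.2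
  have hm : AEStronglyMeasurable f (volume.restrict (closure (strip d))) :=
    hf.2.1.aestronglyMeasurable measurableSet_closure_strip
  refine integrable_norm_sq_of_lintegral hm ?_
  have hpre : sliceEquiv ⁻¹' closure (strip d) = Set.Icc 0 d ×ˢ Set.univ := by
    ext p
    rw [Set.mem_preimage, sliceEquiv_apply, closure_strip hd]
    simp
  rw [← measurePreserving_sliceEquiv.setLIntegral_comp_preimage_emb
    sliceEquiv.measurableEmbedding, hpre, Measure.volume_eq_prod, ← Measure.prod_restrict,
    Measure.restrict_univ, lintegral_prod]
  · calc _ ≤ ∫⁻ t in Set.Icc 0 d, (C : ENNReal) := by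
          refine setLIntegral_mono measurable_const fun t ht => ?_
          simpa only [sliceEquiv_apply] using hC t ht
      _ < ⊤ := by
          rw [setLIntegral_const]
          exact ENNReal.mul_lt_top ENNReal.coe_lt_top (by simp)
  · refine AEMeasurable.pow_const (AEMeasurable.enorm ?_) 2
    have hc : ContinuousOn (fun p => f (sliceEquiv p))
        (Set.Icc 0 d ×ˢ (Set.univ : Set (EuclideanSpace ℝ (Fin 7)))) := by
      rw [← hpre]
      refine hf.2.1.comp ?_ fun p hp => hp
      exact (continuous_slice_uncurry.congr fun p => (sliceEquiv_apply p).symm).continuousOn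
    have := (hc.aestronglyMeasurable (μ := volume)
      (measurableSet_Icc.prod MeasurableSet.univ)).aemeasurable
    rwa [Measure.volume_eq_prod, ← Measure.prod_restrict, Measure.restrict_univ] at this

end core

/-- The elementary Cauchy–Schwarz bound used for domination. -/
lemma mul_le_add_sq (x y : ℝ) : x * y ≤ x ^ 2 + y ^ 2 := by nlinarith [sq_nonneg (x - y)]

lemma measurable_cauchyKernel (ε : ℝ) : Measurable (cauchyKernel ε) := by
  unfold cauchyKernel
  have h := continuous_conj.measurable
  fun_prop

/-! ### Cauchy's formula for the regularized kernel -/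

section regularized

variable {d : ℝ} {f : Octonion → Octonion}

/-- Cauchy's formula in the strip for the regularized kernel. -/
theorem integral_cauchyKernel_slice_sub (hd : 0 < d) (hf : f ∈ hardyCore d) (a : Octonion)
    {ε : ℝ} (hε : 0 < ε) (hε1 : ε ≤ 1) :
    (∫ x, cauchyKernel ε (slice d x - a) * f (slice d x)) -
        ∫ x, cauchyKernel ε (slice 0 x - a) * f (slice 0 x) =
      ∫ z in closure (strip d), peakWeight ε (z - a) • f z := by
  -- The cutoffs χ(r z) with r = 1/(n + 1) tend to 1 pointwise, and each derivative of the cutoff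
  -- carries a factor r that tends to 0.
  let χ : ContDiffBump (0 : Octonion) := ⟨1, 2, one_pos, one_lt_two⟩
  have hχ : ContDiff ℝ 1 χ := χ.contDiff
  have hχd : Continuous (fderiv ℝ χ) := hχ.continuous_fderiv one_ne_zero
  obtain ⟨M, hM⟩ := hχd.bounded_above_of_compact_support (χ.hasCompactSupport.fderiv ℝ)
  let r : ℕ → ℝ := fun n => ((n : ℝ) + 1)⁻¹
  have hr0 : ∀ n, 0 < r n := fun n => by positivity
  have hr1 : ∀ n, r n ≤ 1 := fun n => inv_le_one_of_one_le₀ (by simp)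
  have hr : Tendsto r atTop (𝓝 0) := by
    simpa [r, one_div] using tendsto_one_div_add_atTop_nhds_zero_nat (𝕜 := ℝ)
  have hrz : ∀ z : Octonion, Tendsto (fun n => r n • z) atTop (𝓝 0) := fun z => by
    simpa using hr.smul_const z
  have hχ1 : ∀ z, Tendsto (fun n => χ (r n • z)) atTop (𝓝 1) := fun z => by
    have := (χ.continuous.tendsto 0).comp (hrz z)
    rwa [χ.one_of_mem_closedBall (Metric.mem_closedBall_self χ.rIn_pos.le)] at this
  let G : ℕ → Octonion → Octonion := fun n z => χ (r n • z) • cauchyKernel ε (z - a)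
  have hχr : ∀ n, ContDiff ℝ 1 (fun z : Octonion => χ (r n • z)) := fun n =>
    hχ.comp (contDiff_const_smul (r n))
  have hK : ContDiff ℝ 1 (fun z => cauchyKernel ε (z - a)) :=
    (contDiff_cauchyKernel hε).comp (contDiff_id.sub contDiff_const)
  have hG : ∀ n, ContDiff ℝ 1 (G n) := fun n => (hχr n).smul hK
  have hχs : ∀ n, HasCompactSupport (fun z : Octonion => χ (r n • z)) := fun n =>
    χ.hasCompactSupport.comp_smul (hr0 n).ne'
  have hGs : ∀ n, HasCompactSupport (G n) := fun n =>
    (hχs n).smul_right (f' := fun z => cauchyKernel ε (z - a))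
  have hGd : ∀ n z v, fderiv ℝ (G n) z v = χ (r n • z) • cauchyKernelDeriv ε (z - a) v +
      (r n * fderiv ℝ χ (r n • z) v) • cauchyKernel ε (z - a) := by
    intro n z v
    have h1 : HasFDerivAt (fun z : Octonion => χ (r n • z))
        ((fderiv ℝ χ (r n • z)).comp (r n • ContinuousLinearMap.id ℝ Octonion)) z :=
      ((hχ.differentiable one_ne_zero) _).hasFDerivAt.comp z
        ((hasFDerivAt_id z).const_smul (r n))
    have h2 : HasFDerivAt (fun z => cauchyKernel ε (z - a)) (cauchyKernelDeriv ε (z - a)) z :=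
      (hasFDerivAt_cauchyKernel (by positivity)).comp z ((hasFDerivAt_id z).sub_const a)
    have h3 : HasFDerivAt (G n) _ z := h1.smul h2
    rw [h3.fderiv]
    simp
  have hsum : ∀ n z, ∑ i, fderiv ℝ (G n) z (e i) * (e i * f z) =
      χ (r n • z) • (peakWeight ε (z - a) • f z) +
        ∑ i, (r n * fderiv ℝ χ (r n • z) (e i)) • (cauchyKernel ε (z - a) * (e i * f z)) := by
    intro n z
    simp only [hGd, add_mul_oct, smul_mul_oct, Finset.sum_add_distrib, ← Finset.smul_sum]
    rw [sum_cauchyKernelDeriv_mul (by positivity)]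
    rfl
  -- For fixed ε this constant compares |q|² + ε with 1 + |q|². It degenerates as ε → 0, so the
  -- later limit needs bounds away from the pole.
  have hc : 0 < min 1 ε := lt_min one_pos hε
  have hcq : ∀ q : Octonion, min 1 ε * (1 + ‖q‖ ^ 2) ≤ ‖q‖ ^ 2 + ε := fun q => by
    nlinarith [min_le_left 1 ε, min_le_right 1 ε, sq_nonneg ‖q‖]
  have hface : ∀ t ∈ Set.Icc 0 d,
      Tendsto (fun n => ∫ x, G n (slice t x) * f (slice t x)) atTop
        (𝓝 (∫ x, cauchyKernel ε (slice t x - a) * f (slice t x))) := by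
    intro t ht
    have hfs := continuous_comp_slice hd hf.2.1 ht
    refine tendsto_integral_of_dominated_convergence (fun x =>
      ((min 1 ε) ^ 7)⁻¹ * ((1 + ‖slice t x - a‖ ^ 2) ^ 7)⁻¹ + ‖f (slice t x)‖ ^ 2) (fun n => ?_)
      (((integrable_slice_weight t a).const_mul _).add (integrable_norm_sq_slice hd hf ht))
      (fun n => Eventually.of_forall fun x => ?_) (Eventually.of_forall fun x => ?_)
    · exact (((hG n).continuous.comp (continuous_slice t)).mul hfs).aestronglyMeasurable
    · rw [norm_mul_oct]
      refine (mul_le_add_sq _ _).trans (add_le_add ?_ le_rfl)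
      refine le_trans ?_ (norm_cauchyKernel_sq_le hε.le hc (hcq _))
      gcongr
      rw [norm_smul, Real.norm_of_nonneg χ.nonneg]
      exact mul_le_of_le_one_left (norm_nonneg _) χ.le_one
    · refine Tendsto.mul ?_ tendsto_const_nhds
      simpa using (hχ1 (slice t x)).smul_const (cauchyKernel ε (slice t x - a))
  have hin : Tendsto (fun n => ∫ z in closure (strip d), ∑ i, fderiv ℝ (G n) z (e i) * (e i * f z))
      atTop (𝓝 (∫ z in closure (strip d), peakWeight ε (z - a) • f z)) := by
    have hw := integrable_weight a
    have hfi := integrableOn_norm_sq hd hf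
    have hb : ∀ C : ℝ, Integrable (fun z => C * ((1 + ‖z - a‖ ^ 2) ^ 7)⁻¹ + ‖f z‖ ^ 2)
        (volume.restrict (closure (strip d))) := fun C => (hw.const_mul C).restrict.add hfi
    have hM0 : 0 ≤ M := (norm_nonneg _).trans (hM 0)
    refine tendsto_integral_of_dominated_convergence (fun z =>
      (64 * ((min 1 ε) ^ 10)⁻¹ * ((1 + ‖z - a‖ ^ 2) ^ 7)⁻¹ + ‖f z‖ ^ 2) +
      8 * (M * (((min 1 ε) ^ 7)⁻¹ * ((1 + ‖z - a‖ ^ 2) ^ 7)⁻¹ + ‖f z‖ ^ 2))) (fun n => ?_)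
      ((hb _).add (((hb _).const_mul M).const_mul 8))
      (fun n => Eventually.of_forall fun z => ?_) (Eventually.of_forall fun z => ?_)
    · refine ContinuousOn.aestronglyMeasurable ?_ measurableSet_closure_strip
      refine continuousOn_finsetSum _ fun i _ => ContinuousOn.mul (Continuous.continuousOn ?_)
        (continuousOn_const.mul hf.2.1)
      exact ((hG n).continuous_fderiv one_ne_zero).clm_apply continuous_const
    · rw [hsum]
      refine (norm_add_le _ _).trans (add_le_add ?_ ?_)
      · rw [norm_smul, norm_smul, Real.norm_of_nonneg χ.nonneg,
          Real.norm_of_nonneg (peakWeight_nonneg hε.le _)]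
        refine (mul_le_of_le_one_left (mul_nonneg (peakWeight_nonneg hε.le _) (norm_nonneg _))
          χ.le_one).trans ?_
        exact (mul_le_add_sq _ _).trans
          (add_le_add (peakWeight_sq_le hε.le hε1 hc (hcq _)) le_rfl)
      · refine (norm_sum_le _ _).trans ?_
        refine (Finset.sum_le_card_nsmul Finset.univ _ _ fun i _ => ?_).trans
          (by rw [Finset.card_univ, Fintype.card_fin, nsmul_eq_mul]; norm_num; exact le_rfl)
        rw [norm_smul, norm_mul_oct, norm_mul_oct, norm_e, one_mul, norm_mul,
          Real.norm_of_nonneg (hr0 n).le]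
        have h1 : ‖fderiv ℝ χ (r n • z) (e i)‖ ≤ M := by
          refine ((fderiv ℝ χ (r n • z)).le_opNorm (e i)).trans ?_
          rw [norm_e, mul_one]; exact hM _
        refine mul_le_mul ?_ ((mul_le_add_sq _ _).trans (add_le_add
          (norm_cauchyKernel_sq_le hε.le hc (hcq _)) le_rfl)) (by positivity) hM0
        exact (mul_le_of_le_one_left (norm_nonneg _) (hr1 n)).trans h1
    · simp only [hsum]
      have h1 := (hχ1 z).smul_const (peakWeight ε (z - a) • f z)
      have h2 : Tendsto (fun n => ∑ i, (r n * fderiv ℝ χ (r n • z) (e i)) •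
          (cauchyKernel ε (z - a) * (e i * f z))) atTop (𝓝 (∑ i : Fin 8,
          ((0 : ℝ) * fderiv ℝ χ 0 (e i)) • (cauchyKernel ε (z - a) * (e i * f z)))) := by
        refine tendsto_finsetSum _ fun i _ => Tendsto.smul_const (hr.mul ?_) _
        exact (((hχd.clm_apply continuous_const).tendsto 0).comp (hrz z))
      simpa using h1.add h2
  refine tendsto_nhds_unique (((hface d ⟨hd.le, le_rfl⟩).sub (hface 0 ⟨le_rfl, hd.le⟩)).congr
    fun n => ?_) hin
  exact integral_slice_sub_integral_slice hd hf.1 hf.2.1 (hG n) (hGs n)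

end regularized

/-! ### The peaks as an approximate identity -/

lemma integral_Ioi_pow_seven_div :
    ∫ y in Set.Ioi (0 : ℝ), y ^ 7 * ((1 + y ^ 2) ^ 5)⁻¹ = 1 / 8 := by
  have h := integral_Ioi_of_hasDerivAt_of_nonneg' (a := 0) (l := 1 / 8)
    (g := fun y : ℝ => 1 / 8 * (y ^ 2 / (1 + y ^ 2)) ^ 4)
    (g' := fun y : ℝ => y ^ 7 * ((1 + y ^ 2) ^ 5)⁻¹)
    (fun y _ => ?_) (fun y hy => ?_) ?_
  · simpa using h
  · have h0 : 1 + y ^ 2 ≠ 0 := by positivity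
    have h1 : HasDerivAt (fun y : ℝ => 1 + y ^ 2) (2 * y) y := by
      simpa using (hasDerivAt_pow 2 y).const_add 1
    have h2 : HasDerivAt (fun y : ℝ => y ^ 2) (2 * y) y := by simpa using hasDerivAt_pow 2 y
    have h3 : HasDerivAt (fun y : ℝ => y ^ 2 / (1 + y ^ 2)) (2 * y / (1 + y ^ 2) ^ 2) y := by
      convert! h2.div h1 h0 using 1
      ring
    convert! (h3.pow 4).const_mul (1 / 8) using 1
    norm_num
    field_simp
    ring
  · have : (0 : ℝ) < y := hy
    positivity
  · have h1 : Tendsto (fun y : ℝ => (1 + y ^ 2)⁻¹) atTop (𝓝 0) :=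
      tendsto_inv_atTop_zero.comp (tendsto_atTop_add_const_left _ _ (tendsto_pow_atTop two_ne_zero))
    have h2 : Tendsto (fun y : ℝ => 1 / 8 * (1 - (1 + y ^ 2)⁻¹) ^ 4) atTop
        (𝓝 (1 / 8 * (1 - 0) ^ 4)) := ((tendsto_const_nhds.sub h1).pow 4).const_mul _
    rw [show (1 : ℝ) / 8 * (1 - 0) ^ 4 = 1 / 8 by norm_num] at h2
    refine h2.congr fun y => ?_
    congr 2
    field_simp
    ring

lemma volume_real_unit_ball : (volume : Measure Octonion).real (Metric.ball 0 1) =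
    Real.pi ^ 4 / 24 := by
  rw [measureReal_def, EuclideanSpace.volume_ball]
  have h : Real.Gamma ((Fintype.card (Fin 8) : ℝ) / 2 + 1) = 24 := by
    have := Real.Gamma_nat_eq_factorial 4
    rw [Fintype.card_fin]
    norm_num [Nat.factorial] at this ⊢
  rw [h, Fintype.card_fin, show Real.sqrt Real.pi ^ 8 = (Real.sqrt Real.pi ^ 2) ^ 4 by ring,
    Real.sq_sqrt Real.pi_pos.le]
  simp
  positivity

lemma integral_inv_one_add_norm_sq_pow_five :
    ∫ z : Octonion, ((1 + ‖z‖ ^ 2) ^ 5)⁻¹ = Real.pi ^ 4 / 24 := by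
  rw [integral_fun_norm_addHaar volume (fun y => ((1 + y ^ 2) ^ 5)⁻¹), volume_real_unit_ball]
  simp only [finrank_euclideanSpace, Fintype.card_fin, smul_eq_mul, nsmul_eq_mul]
  norm_num only
  rw [integral_Ioi_pow_seven_div]
  ring

/-- The parameters `(n + 1)⁻²` of the regularization. -/
def regParam (n : ℕ) : ℝ := (((n : ℝ) + 1) ^ 2)⁻¹

lemma regParam_pos (n : ℕ) : 0 < regParam n := by unfold regParam; positivity

lemma regParam_le_one (n : ℕ) : regParam n ≤ 1 :=
  inv_le_one_of_one_le₀ (one_le_pow₀ (by simp))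

lemma tendsto_regParam : Tendsto regParam atTop (𝓝 0) := by
  have h := (tendsto_one_div_add_atTop_nhds_zero_nat (𝕜 := ℝ)).pow 2
  simpa [regParam, funext_iff] using h.congr fun n => show _ = regParam n by simp [regParam]

/-- The weights are an approximate identity of mass `π⁴/3`. -/
lemma tendsto_integral_peakWeight {g : Octonion → Octonion} {a : Octonion} (hg : Integrable g)
    (hga : ContinuousAt g a) :
    Tendsto (fun n => ∫ z, peakWeight (regParam n) (z - a) • g z) atTop
      (𝓝 ((Real.pi ^ 4 / 3) • g a)) := by
  have hpi := Real.pi_pos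
  have hfr : Module.finrank ℝ Octonion = 8 := by simp
  -- For ε = c⁻² with c = n + 1 the peak is 8c⁸(1 + |cq|²)⁻⁵, a dilation of a fixed profile. The
  -- factor 24/π⁴ normalizes the profile to mass 1, and 8 · π⁴/24 = π⁴/3.
  have h := tendsto_integral_comp_smul_smul_of_integrable' (μ := (volume : Measure Octonion))
    (φ := fun z : Octonion => 24 / Real.pi ^ 4 * ((1 + ‖z‖ ^ 2) ^ 5)⁻¹)
    (fun z => by positivity) ?_ ?_ hg hga
  · have h1 : Tendsto (fun n : ℕ => (n : ℝ) + 1) atTop atTop :=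
      tendsto_atTop_add_const_right _ _ tendsto_natCast_atTop_atTop
    refine ((h.comp h1).const_smul (Real.pi ^ 4 / 3)).congr fun n => ?_
    simp only [Function.comp_apply]
    rw [← integral_smul]
    refine integral_congr_ae (Eventually.of_forall fun z => ?_)
    simp only [smul_smul, hfr]
    congr 1
    rw [norm_smul, norm_sub_rev, Real.norm_of_nonneg (by positivity), peakWeight, regParam]
    field_simp
    ring
  · rw [integral_const_mul, integral_inv_one_add_norm_sq_pow_five]
    field_simp
  · rw [hfr]
    have h1 : Tendsto (fun z : Octonion => 24 / Real.pi ^ 4 * (‖z‖ ^ 2)⁻¹)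
        (Bornology.cobounded Octonion) (𝓝 (24 / Real.pi ^ 4 * 0)) :=
      (tendsto_inv_atTop_zero.comp ((tendsto_pow_atTop two_ne_zero).comp
        tendsto_norm_cobounded_atTop)).const_mul _
    rw [mul_zero] at h1
    refine squeeze_zero' (Eventually.of_forall fun z => by positivity) ?_ h1
    filter_upwards [tendsto_norm_cobounded_atTop.eventually (eventually_gt_atTop 0)] with z hz
    rw [mul_left_comm]
    gcongr
    rw [← div_eq_mul_inv, div_le_iff₀ (by positivity), inv_mul_eq_div, le_div_iff₀ (by positivity),
      ← pow_add]
    calc ‖z‖ ^ (8 + 2) = (‖z‖ ^ 2) ^ 5 := by ring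
      _ ≤ (1 + ‖z‖ ^ 2) ^ 5 := by gcongr; linarith

lemma continuous_peakWeight_sub {ε : ℝ} (hε : 0 < ε) (a : Octonion) :
    Continuous fun z => peakWeight ε (z - a) := by
  unfold peakWeight
  exact continuous_const.mul (Continuous.inv₀ (by fun_prop) fun z => by positivity)

/-- A lower bound of the kind needed for domination. -/
lemma weight_le_of_le_norm {δ ε : ℝ} (hδ : 0 < δ) (hε : 0 ≤ ε) {q : Octonion} (h : δ ≤ ‖q‖) :
    δ ^ 2 / (1 + δ ^ 2) * (1 + ‖q‖ ^ 2) ≤ ‖q‖ ^ 2 + ε := by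
  rw [div_mul_eq_mul_div, div_le_iff₀ (by positivity)]
  have : δ ^ 2 ≤ ‖q‖ ^ 2 := by gcongr
  nlinarith [sq_nonneg δ]

/-! ### Cauchy's formula in the strip -/

section cauchy

variable {d : ℝ} {f : Octonion → Octonion}

lemma abs_coord_sub_le_norm_slice_sub (t : ℝ) (x : EuclideanSpace ℝ (Fin 7)) (a : Octonion) :
    |t - a 0| ≤ ‖slice t x - a‖ := by
  simpa using abs_coord_le (slice t x - a) 0

lemma slice_sub_ne_zero {t : ℝ} {a : Octonion} (h : t ≠ a 0) (x : EuclideanSpace ℝ (Fin 7)) :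
    slice t x - a ≠ 0 :=
  norm_pos_iff.1 ((abs_pos.2 (sub_ne_zero.2 h)).trans_le (abs_coord_sub_le_norm_slice_sub t x a))

/-- The pole is at distance at least |t - a₀| from the hyperplane, which gives a domination
independent of ε. -/
lemma tendsto_integral_cauchyKernel_slice (hd : 0 < d) (hf : f ∈ hardyCore d) {a : Octonion}
    {t : ℝ} (ht : t ∈ Set.Icc 0 d) (hta : t ≠ a 0) :
    Tendsto (fun n => ∫ x, cauchyKernel (regParam n) (slice t x - a) * f (slice t x)) atTop
      (𝓝 (∫ x, cauchyKernel 0 (slice t x - a) * f (slice t x))) := by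
  have hfs := continuous_comp_slice hd hf.2.1 ht
  have hδ : 0 < |t - a 0| := abs_pos.2 (sub_ne_zero.2 hta)
  have hδ' := fun x => abs_coord_sub_le_norm_slice_sub t x a
  set δ := |t - a 0|
  refine tendsto_integral_of_dominated_convergence (fun x =>
    ((δ ^ 2 / (1 + δ ^ 2)) ^ 7)⁻¹ * ((1 + ‖slice t x - a‖ ^ 2) ^ 7)⁻¹ + ‖f (slice t x)‖ ^ 2)
    (fun n => ?_)
    (((integrable_slice_weight t a).const_mul _).add (integrable_norm_sq_slice hd hf ht))
    (fun n => Eventually.of_forall fun x => ?_) (Eventually.of_forall fun x => ?_)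
  · have h1 : Measurable fun x => cauchyKernel (regParam n) (slice t x - a) :=
      (measurable_cauchyKernel _).comp ((continuous_slice t).sub continuous_const).measurable
    exact (h1.mul hfs.measurable).aestronglyMeasurable
  · rw [norm_mul_oct]
    exact (mul_le_add_sq _ _).trans (add_le_add (norm_cauchyKernel_sq_le (regParam_pos n).le
      (by positivity) (weight_le_of_le_norm hδ (regParam_pos n).le (hδ' x))) le_rfl)
  · exact Tendsto.mul ((tendsto_cauchyKernel (slice_sub_ne_zero hta x)).comp tendsto_regParam)
      tendsto_const_nhds

/-- At distance at least 1 from the pole the peaks tend to 0 pointwise under a common integrable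
bound. -/
lemma tendsto_setIntegral_peakWeight_diff_ball (hd : 0 < d) (hf : f ∈ hardyCore d)
    (a : Octonion) :
    Tendsto (fun n => ∫ z in closure (strip d) \ Metric.ball a 1,
      peakWeight (regParam n) (z - a) • f z) atTop (𝓝 0) := by
  have hms : MeasurableSet (closure (strip d) \ Metric.ball a 1) :=
    measurableSet_closure_strip.diff measurableSet_ball
  have hge : ∀ z ∈ closure (strip d) \ Metric.ball a 1, 1 ≤ ‖z - a‖ := fun z hz => by
    simpa [dist_eq_norm] using hz.2
  have h := tendsto_integral_of_dominated_convergence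
    (μ := volume.restrict (closure (strip d) \ Metric.ball a 1))
    (F := fun n z => peakWeight (regParam n) (z - a) • f z) (f := fun _ => 0)
    (fun z => 64 * (((1 : ℝ) ^ 2 / (1 + 1 ^ 2)) ^ 10)⁻¹ * ((1 + ‖z - a‖ ^ 2) ^ 7)⁻¹ + ‖f z‖ ^ 2)
    (fun n => ?_)
    (((integrable_weight a).const_mul _).restrict.add
      ((integrableOn_norm_sq hd hf).mono_set Set.sdiff_subset))
    (fun n => ?_) ?_
  · simpa using h
  · have h1 := (continuous_peakWeight_sub (regParam_pos n) a).continuousOn.smul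
      (hf.2.1.mono (Set.sdiff_subset (t := Metric.ball a 1)))
    exact h1.aestronglyMeasurable hms
  · filter_upwards [ae_restrict_mem hms] with z hz
    rw [norm_smul, Real.norm_of_nonneg (peakWeight_nonneg (regParam_pos n).le _)]
    exact (mul_le_add_sq _ _).trans (add_le_add (peakWeight_sq_le (regParam_pos n).le
      (regParam_le_one n) (by positivity) (weight_le_of_le_norm one_pos (regParam_pos n).le
        (hge z hz))) le_rfl)
  · filter_upwards [ae_restrict_mem hms] with z hz
    have h0 : 0 < ‖z - a‖ := one_pos.trans_le (hge z hz)
    have h1 : ContinuousAt (fun ε => peakWeight ε (z - a)) 0 := by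
      have h2 : ContinuousAt (fun ε : ℝ => (‖z - a‖ ^ 2 + ε) ^ 5) 0 := by fun_prop
      exact ContinuousAt.mul (by fun_prop) (h2.inv₀ (by positivity))
    have h3 := ((h1.tendsto.comp tendsto_regParam).smul_const (f z))
    simpa [peakWeight] using h3

/-- Cauchy's formula in the strip, with the value at `a` of the zero extension of `f`. -/
theorem integral_cauchyKernel_zero_slice_sub (hd : 0 < d) (hf : f ∈ hardyCore d) {a v : Octonion}
    (ha0 : 0 ≠ a 0) (had : d ≠ a 0)
    (hv : (closure (strip d)).indicator f =ᶠ[𝓝 a] f ∧ v = f a ∧ a ∈ strip d ∨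
      (closure (strip d)).indicator f =ᶠ[𝓝 a] 0 ∧ v = 0) :
    (∫ x, cauchyKernel 0 (slice d x - a) * f (slice d x)) -
        ∫ x, cauchyKernel 0 (slice 0 x - a) * f (slice 0 x) = (Real.pi ^ 4 / 3) • v := by
  have hms : MeasurableSet (closure (strip d) ∩ Metric.ball a 1) :=
    measurableSet_closure_strip.inter measurableSet_ball
  -- On the strip f is only known to be square integrable, whereas the approximate identity needs an
  -- integrable function. Truncation to the unit ball around a suffices, since there |f| ≤ 1 + |f|²
  -- and the measure is finite.
  let g : Octonion → Octonion := (closure (strip d) ∩ Metric.ball a 1).indicator f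
  have hge : g =ᶠ[𝓝 a] (closure (strip d)).indicator f := by
    filter_upwards [Metric.ball_mem_nhds a one_pos] with z hz
    by_cases h : z ∈ closure (strip d)
    · simp only [g, Set.indicator_of_mem h, Set.indicator_of_mem (Set.mem_inter h hz)]
    · simp only [g, Set.indicator_of_notMem h,
        Set.indicator_of_notMem (fun h' : z ∈ closure (strip d) ∩ Metric.ball a 1 => h h'.1)]
  have hgc : ContinuousAt g a ∧ g a = v := by
    rcases hv with ⟨h1, rfl, h2⟩ | ⟨h1, rfl⟩
    · have h3 := hge.trans h1
      exact ⟨((hf.1 a h2).1.continuousAt).congr h3.symm, h3.eq_of_nhds⟩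
    · have h3 := hge.trans h1
      exact ⟨(continuousAt_const (y := (0 : Octonion))).congr h3.symm, h3.eq_of_nhds⟩
  have hgi : Integrable g := by
    refine IntegrableOn.integrable_indicator ?_ hms
    have h1 : IntegrableOn (fun z => 1 + ‖f z‖ ^ 2) (closure (strip d) ∩ Metric.ball a 1) := by
      refine Integrable.add ?_ ((integrableOn_norm_sq hd hf).mono_set Set.inter_subset_left)
      refine integrableOn_const ?_
      exact ((measure_mono Set.inter_subset_right).trans_lt measure_ball_lt_top).ne
    refine h1.mono' ?_ (Eventually.of_forall fun z => ?_)
    · exact (hf.2.1.mono Set.inter_subset_left).aestronglyMeasurable hms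
    · nlinarith [sq_nonneg (‖f z‖ - 1), norm_nonneg (f z)]
  have hlhs := (tendsto_integral_cauchyKernel_slice hd hf ⟨hd.le, le_rfl⟩ had).sub
    (tendsto_integral_cauchyKernel_slice hd hf ⟨le_rfl, hd.le⟩ ha0)
  refine tendsto_nhds_unique hlhs ?_
  have hrhs := (tendsto_integral_peakWeight hgi hgc.1).add
    (tendsto_setIntegral_peakWeight_diff_ball hd hf a)
  rw [hgc.2, add_zero] at hrhs
  refine hrhs.congr fun n => ?_
  rw [integral_cauchyKernel_slice_sub hd hf a (regParam_pos n) (regParam_le_one n)]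
  have hint : IntegrableOn (fun z => peakWeight (regParam n) (z - a) • f z)
      (closure (strip d)) := by
    have := regParam_pos n
    have h1 := regParam_le_one n
    refine (((integrable_weight a).const_mul (64 * ((regParam n) ^ 10)⁻¹)).restrict.add
      (integrableOn_norm_sq hd hf)).mono' ?_ (Eventually.of_forall fun z => ?_)
    · have h2 := (continuous_peakWeight_sub this a).continuousOn.smul hf.2.1
      exact h2.aestronglyMeasurable measurableSet_closure_strip
    · rw [norm_smul, Real.norm_of_nonneg (peakWeight_nonneg (regParam_pos n).le _)]
      refine (mul_le_add_sq _ _).trans (add_le_add (peakWeight_sq_le this.le h1 this ?_) le_rfl)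
      nlinarith [sq_nonneg ‖z - a‖]
  rw [← integral_inter_add_sdiff measurableSet_ball hint, ← integral_indicator hms]
  congr 2
  ext1 z
  exact (Set.indicator_smul_apply _ (fun z => peakWeight (regParam n) (z - a)) f z).symm

lemma integral_cauchyKernel_of_mem (hd : 0 < d) (hf : f ∈ hardyCore d) {a : Octonion}
    (ha : a ∈ strip d) :
    (∫ x, cauchyKernel 0 (slice d x - a) * f (slice d x)) -
        ∫ x, cauchyKernel 0 (slice 0 x - a) * f (slice 0 x) = (Real.pi ^ 4 / 3) • f a := by
  refine integral_cauchyKernel_zero_slice_sub hd hf ha.1.ne ha.2.ne' (Or.inl ⟨?_, rfl, ha⟩)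
  filter_upwards [(isOpen_strip d).mem_nhds ha] with z hz
  exact Set.indicator_of_mem (subset_closure hz) f

lemma integral_cauchyKernel_of_notMem (hd : 0 < d) (hf : f ∈ hardyCore d) {a : Octonion}
    (ha : a ∉ closure (strip d)) :
    (∫ x, cauchyKernel 0 (slice d x - a) * f (slice d x)) -
        ∫ x, cauchyKernel 0 (slice 0 x - a) * f (slice 0 x) = 0 := by
  have h := ha
  rw [closure_strip hd] at h
  have hev : (closure (strip d)).indicator f =ᶠ[𝓝 a] 0 := by
    filter_upwards [isClosed_closure.isOpen_compl.mem_nhds ha] with z hz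
    exact Set.indicator_of_notMem hz f
  have h0 := integral_cauchyKernel_zero_slice_sub (a := a) (v := 0) hd hf
    (fun h0 => h ⟨h0.le, by rw [← h0]; exact hd.le⟩)
    (fun h0 => h ⟨by rw [← h0]; exact hd.le, h0.ge⟩) (Or.inr ⟨hev, rfl⟩)
  rwa [smul_zero] at h0

end cauchy

/-! ### Convergence and regularity of the kernel series -/

section series

variable {d : ℝ} {w : Octonion}

lemma conj_add_conj_add_ofReal (z w : Octonion) (t : ℝ) :
    conj (z + conj w + ofReal t) = conj z + w + ofReal t := by
  rw [conj_add, conj_add, conj_conj, conj_ofReal]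

lemma szegoTerm_eq (d : ℝ) (z w : Octonion) (n : ℤ) : szegoTerm d z w n =
    (-1 : ℝ) ^ n • cauchyKernel 0 (z + conj w + ofReal (2 * d * n)) := by
  rw [szegoTerm, cauchyKernel, ← conj_add_conj_add_ofReal, norm_conj, smul_smul, add_zero,
    ← pow_mul, div_eq_mul_inv]

/-- The poles of the terms of the series stay away from the closed strip, uniformly and with
linear growth. -/
lemma exists_le_norm_pole (hw : w ∈ strip d) : ∃ c > 0, ∀ z ∈ closure (strip d), ∀ n : ℤ,
    c * (1 + |(n : ℝ)|) ≤ ‖z + conj w + ofReal (2 * d * n)‖ ∧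
      c * (1 + ‖z‖) ≤ ‖z + conj w + ofReal (2 * d * n)‖ := by
  obtain ⟨hw0, hwd⟩ := hw
  have hd : 0 < d := hw0.trans hwd
  rw [closure_strip hd]
  -- The real part of the pole expression is at least w₀ + 2dn for n ≥ 0 and at most d + w₀ - 2d|n|
  -- for n < 0. The extremal cases n = 0 and n = -1 require c ≤ w₀ and 2c ≤ d - w₀.
  obtain ⟨c, hc, hc1, hc2⟩ : ∃ c > 0, c ≤ w 0 ∧ 2 * c ≤ d - w 0 :=
    ⟨min (w 0) ((d - w 0) / 2), lt_min hw0 (by linarith), min_le_left _ _, by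
      linarith [min_le_right (w 0) ((d - w 0) / 2)]⟩
  have key : ∀ z : Octonion, 0 ≤ z 0 ∧ z 0 ≤ d → ∀ n : ℤ,
      c * (1 + |(n : ℝ)|) ≤ ‖z + conj w + ofReal (2 * d * n)‖ := by
    rintro z ⟨hz0, hzd⟩ n
    refine le_trans ?_ (abs_coord_le _ 0)
    simp only [PiLp.add_apply, ofReal_coord0, conj_coord0]
    rcases le_or_gt 0 n with hn | hn
    · have hn' : (0 : ℝ) ≤ n := by exact_mod_cast hn
      rw [abs_of_nonneg hn']
      refine le_trans ?_ (le_abs_self _)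
      nlinarith
    · have hn' : (n : ℝ) ≤ -1 := by exact_mod_cast Int.le_sub_one_of_lt hn
      rw [abs_of_neg (by linarith)]
      refine le_trans ?_ (neg_le_abs _)
      nlinarith
  -- The divisor comes from |z| ≤ |q| + |w| + 2d|n|: multiplying by c and using c ≤ |q| and c|n| ≤
  -- |q| yields c(1 + |z|) ≤ (1 + 2d + |w| + c)|q|.
  have hpos : 0 < 1 + 2 * d + ‖w‖ + c := by positivity
  refine ⟨c / (1 + 2 * d + ‖w‖ + c), by positivity, fun z hz n => ⟨?_, ?_⟩⟩
  · refine le_trans ?_ (key z hz n)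
    gcongr
    exact div_le_self hc.le (by linarith [norm_nonneg w])
  · have h1 := key z hz n
    set q := z + conj w + ofReal (2 * d * n)
    have h2 : ‖ofReal (2 * d * n)‖ = 2 * d * |(n : ℝ)| := by
      rw [ofReal, norm_smul, norm_e, mul_one, Real.norm_eq_abs, abs_mul, abs_of_pos (by positivity)]
    have h3 : ‖z‖ ≤ ‖q‖ + ‖w‖ + 2 * d * |(n : ℝ)| := by
      rw [← h2, ← norm_conj w]
      calc ‖z‖ = ‖q - conj w - ofReal (2 * d * n)‖ := by congr 1; simp only [q]; abel
        _ ≤ ‖q - conj w‖ + ‖ofReal (2 * d * n)‖ := norm_sub_le _ _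
        _ ≤ _ := by gcongr; exact norm_sub_le _ _
    rw [div_mul_eq_mul_div, div_le_iff₀ hpos]
    have h4 := norm_nonneg w
    have h5 := norm_nonneg q
    have h6 := abs_nonneg (n : ℝ)
    have h7 : c ≤ ‖q‖ := by nlinarith
    have h8 : c * |(n : ℝ)| ≤ ‖q‖ := by nlinarith
    nlinarith [mul_le_mul_of_nonneg_left h3 hc.le, mul_le_mul_of_nonneg_left h7 h4,
      mul_le_mul_of_nonneg_left h8 hd.le]

/-- The weights that dominate the terms of the series. -/
def seriesWeight (n : ℤ) : ℝ := ((1 + |(n : ℝ)|) ^ 2)⁻¹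

lemma seriesWeight_nonneg (n : ℤ) : 0 ≤ seriesWeight n := by unfold seriesWeight; positivity

lemma summable_seriesWeight : Summable seriesWeight := by
  have h : Summable fun n : ℕ => (((n : ℝ) + 1) ^ 2)⁻¹ := by
    have := (summable_nat_add_iff 1).2 (Real.summable_nat_pow_inv.2 one_lt_two)
    simpa using this
  refine Summable.of_nat_of_neg (h.congr fun n => ?_) (h.congr fun n => ?_) <;>
    simp [seriesWeight, add_comm]

/-- Of the seven powers of |q|⁻¹, two are spent on summability in n and five on decay in z, whose
square has order 10 > 7 and is integrable on hyperplanes. The last bound controls the derivatives of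
the terms. -/
lemma exists_norm_szegoTerm_le (hw : w ∈ strip d) : ∃ C > 0, ∀ z ∈ closure (strip d), ∀ n : ℤ,
    z + conj w + ofReal (2 * d * n) ≠ 0 ∧
    ‖szegoTerm d z w n‖ ≤ seriesWeight n * (C * ((1 + ‖z‖) ^ 5)⁻¹) ∧
    9 * (‖z + conj w + ofReal (2 * d * n)‖ ^ 8)⁻¹ ≤ seriesWeight n * C := by
  obtain ⟨c, hc, h⟩ := exists_le_norm_pole hw
  refine ⟨max (c ^ 7)⁻¹ (9 * (c ^ 8)⁻¹), by positivity, fun z hz n => ?_⟩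
  obtain ⟨h1, h2⟩ := h z hz n
  rw [szegoTerm_eq, norm_smul, norm_cauchyKernel_zero, norm_zpow, norm_neg, norm_one, one_zpow,
    one_mul]
  set q := z + conj w + ofReal (2 * d * n)
  have hq : 0 < ‖q‖ := lt_of_lt_of_le (by positivity) h1
  refine ⟨norm_pos_iff.1 hq, ?_, ?_⟩
  · calc (‖q‖ ^ 7)⁻¹ = (‖q‖ ^ 2 * ‖q‖ ^ 5)⁻¹ := by rw [← pow_add]
      _ ≤ ((c * (1 + |(n : ℝ)|)) ^ 2 * (c * (1 + ‖z‖)) ^ 5)⁻¹ := by gcongr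
      _ = seriesWeight n * ((c ^ 7)⁻¹ * ((1 + ‖z‖) ^ 5)⁻¹) := by
        unfold seriesWeight; field_simp
      _ ≤ _ := by
        have := seriesWeight_nonneg n
        gcongr
        exact le_max_left _ _
  · have h3 : c ≤ ‖q‖ := by nlinarith [norm_nonneg z]
    calc 9 * (‖q‖ ^ 8)⁻¹ = 9 * (‖q‖ ^ 2 * ‖q‖ ^ 6)⁻¹ := by rw [← pow_add]
      _ ≤ 9 * ((c * (1 + |(n : ℝ)|)) ^ 2 * c ^ 6)⁻¹ := by gcongr
      _ = seriesWeight n * (9 * (c ^ 8)⁻¹) := by unfold seriesWeight; field_simp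
      _ ≤ _ := by
        have := seriesWeight_nonneg n
        gcongr
        exact le_max_right _ _

lemma summable_szegoTerm (hw : w ∈ strip d) {z : Octonion} (hz : z ∈ closure (strip d)) :
    Summable (szegoTerm d z w) := by
  obtain ⟨C, -, h⟩ := exists_norm_szegoTerm_le hw
  exact (summable_seriesWeight.mul_right _).of_norm_bounded fun n => (h z hz n).2.1

lemma hasFDerivAt_szegoTerm (hw : w ∈ strip d) {z : Octonion} (hz : z ∈ closure (strip d))
    (n : ℤ) : HasFDerivAt (fun z => szegoTerm d z w n)
      ((-1 : ℝ) ^ n • cauchyKernelDeriv 0 (z + conj w + ofReal (2 * d * n))) z := by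
  obtain ⟨C, -, h⟩ := exists_norm_szegoTerm_le hw
  have h0 := norm_pos_iff.2 (h z hz n).1
  simp only [szegoTerm_eq]
  have h1 : HasFDerivAt (fun z => z + conj w + ofReal (2 * d * n))
      (ContinuousLinearMap.id ℝ Octonion) z :=
    ((hasFDerivAt_id z).add_const _).add_const _
  have h2 := (hasFDerivAt_cauchyKernel (ε := 0) (q := z + conj w + ofReal (2 * d * n))
    (by positivity)).comp z h1
  exact h2.const_smul ((-1 : ℝ) ^ n)

lemma continuousOn_szegoTerm (hw : w ∈ strip d) (n : ℤ) :
    ContinuousOn (fun z => szegoTerm d z w n) (closure (strip d)) := fun _ hz =>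
  (hasFDerivAt_szegoTerm hw hz n).continuousAt.continuousWithinAt

lemma continuousOn_szegoSeries (hw : w ∈ strip d) :
    ContinuousOn (fun z => szegoSeries d z w) (closure (strip d)) := by
  obtain ⟨C, hC, h⟩ := exists_norm_szegoTerm_le hw
  refine continuousOn_tsum (continuousOn_szegoTerm hw) (summable_seriesWeight.mul_right C)
    fun n z hz => (h z hz n).2.1.trans ?_
  refine mul_le_mul_of_nonneg_left ?_ (seriesWeight_nonneg n)
  exact mul_le_of_le_one_right hC.le
    (inv_le_one_of_one_le₀ (one_le_pow₀ (by linarith [norm_nonneg z])))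

lemma isPreconnected_strip : IsPreconnected (strip d) := by
  refine Convex.isPreconnected ?_
  exact (convex_Ioo 0 d).linear_preimage (EuclideanSpace.proj 0 : Octonion →L[ℝ] ℝ).toLinearMap

lemma leftRegularOn_szegoSeries (hw : w ∈ strip d) :
    LeftRegularOn (fun z => szegoSeries d z w) (strip d) := by
  obtain ⟨C, hC, h⟩ := exists_norm_szegoTerm_le hw
  intro z hz
  let D : ℤ → Octonion → Octonion →L[ℝ] Octonion := fun n z =>
    (-1 : ℝ) ^ n • cauchyKernelDeriv 0 (z + conj w + ofReal (2 * d * n))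
  have hD : ∀ n, ∀ z ∈ strip d, ‖D n z‖ ≤ seriesWeight n * C := fun n z hz => by
    obtain ⟨h1, -, h2⟩ := h z (subset_closure hz) n
    refine le_trans ?_ ((norm_cauchyKernelDeriv_zero_le h1).trans h2)
    rw [norm_smul, norm_zpow, norm_neg, norm_one, one_zpow, one_mul]
  have hsum := summable_seriesWeight.mul_right C
  have hder : HasFDerivAt (fun z => szegoSeries d z w) (∑' n, D n z) z :=
    hasFDerivAt_tsum_of_isPreconnected hsum (isOpen_strip d) isPreconnected_strip
      (fun n z hz => hasFDerivAt_szegoTerm hw (subset_closure hz) n) hD hz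
      (summable_szegoTerm hw (subset_closure hz)) hz
  refine ⟨hder.differentiableAt, ?_⟩
  rw [hder.fderiv]
  have hDs : Summable fun n => D n z := hsum.of_norm_bounded fun n => hD n z hz
  -- The Cauchy–Riemann operator is a continuous linear map of the derivative, so it can be applied
  -- termwise.
  let T : (Octonion →L[ℝ] Octonion) →L[ℝ] Octonion :=
    ∑ i, (mulL (e i)).comp (ContinuousLinearMap.apply ℝ Octonion (e i))
  have hT : ∀ A : Octonion →L[ℝ] Octonion, T A = ∑ i, e i * A (e i) := fun A => by
    simp [T, mulL_apply]
  rw [← hT, T.map_tsum hDs]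
  refine (tsum_congr fun n => ?_).trans tsum_zero
  rw [T.map_smul, hT, sum_mul_cauchyKernelDeriv (h z (subset_closure hz) n).1, smul_zero]

lemma exists_norm_szegoSeries_le (hw : w ∈ strip d) : ∃ C > 0, ∀ z ∈ closure (strip d),
    ∑' n, ‖szegoTerm d z w n‖ ≤ C * ((1 + ‖z‖) ^ 5)⁻¹ ∧
    ‖szegoSeries d z w‖ ≤ C * ((1 + ‖z‖) ^ 5)⁻¹ := by
  obtain ⟨C, hC, h⟩ := exists_norm_szegoTerm_le hw
  have hW : 0 < ∑' n, seriesWeight n :=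
    summable_seriesWeight.tsum_pos seriesWeight_nonneg 0 (by simp [seriesWeight])
  refine ⟨(∑' n, seriesWeight n) * C, by positivity, fun z hz => ?_⟩
  have hs := summable_seriesWeight.mul_right (C * ((1 + ‖z‖) ^ 5)⁻¹)
  have hn : Summable fun n => ‖szegoTerm d z w n‖ :=
    Summable.of_nonneg_of_le (fun n => norm_nonneg _) (fun n => (h z hz n).2.1) hs
  rw [mul_assoc, ← tsum_mul_right]
  have h1 := hn.tsum_le_tsum (fun n => (h z hz n).2.1) hs
  exact ⟨h1, (norm_tsum_le_tsum_norm hn).trans h1⟩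

lemma inv_one_add_norm_slice_le (t : ℝ) (x : EuclideanSpace ℝ (Fin 7)) :
    (((1 + ‖slice t x‖) ^ 5)⁻¹) ^ 2 ≤ ((1 + ‖x - 0‖ ^ 2) ^ 5)⁻¹ := by
  rw [sub_zero, inv_pow, ← pow_mul, mul_comm 5 2, pow_mul]
  have h := norm_slice_sq t x
  gcongr
  nlinarith [sq_nonneg t, norm_nonneg (slice t x)]

lemma integrable_slice_bound : Integrable fun x : EuclideanSpace ℝ (Fin 7) =>
    ((1 + ‖x - 0‖ ^ 2) ^ 5)⁻¹ :=
  integrable_inv_one_add_norm_sq_pow (by simp) 0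

lemma szegoSeries_mem_hardyCore (hw : w ∈ strip d) :
    (fun z => szegoSeries d z w) ∈ hardyCore d := by
  have hd : 0 < d := hw.1.trans hw.2
  refine ⟨leftRegularOn_szegoSeries hw, continuousOn_szegoSeries hw, ?_⟩
  obtain ⟨C, hC, h⟩ := exists_norm_szegoSeries_le hw
  have hfin := ((integrable_slice_bound).const_mul (C ^ 2)).lintegral_lt_top
  refine ⟨(∫⁻ x : EuclideanSpace ℝ (Fin 7),
    ENNReal.ofReal (C ^ 2 * ((1 + ‖x - 0‖ ^ 2) ^ 5)⁻¹)).toNNReal, fun t ht => ?_⟩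
  rw [ENNReal.coe_toNNReal hfin.ne]
  refine lintegral_mono fun x => ?_
  rw [← ofReal_norm, ← ENNReal.ofReal_pow (norm_nonneg _)]
  refine ENNReal.ofReal_le_ofReal ?_
  calc _ ≤ (C * ((1 + ‖slice t x‖) ^ 5)⁻¹) ^ 2 := by
        gcongr; exact (h _ (slice_mem_closure_strip hd ht x)).2
    _ ≤ _ := by
        rw [mul_pow]
        gcongr
        exact inv_one_add_norm_slice_le t x

/-- The terms of the kernel are the rescaled terms of the cosecant. -/
lemma szegoTerm_eq_smul_cscTerm {d : ℝ} (hd : 0 < d) (z w : Octonion) (n : ℤ) :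
    szegoTerm d z w n = (Real.pi / (2 * d)) ^ 7 •
      cscTerm ((Real.pi / (2 * d)) • (z + conj w)) n := by
  have hpi := Real.pi_pos
  set r := Real.pi / (2 * d) with hr
  have hr0 : 0 < r := by positivity
  have h1 : ofReal (Real.pi * n) = r • ofReal (2 * d * n) := by
    rw [smul_ofReal, hr]; congr 1; field_simp
  have h2 : ‖r • (z + conj w + ofReal (2 * d * n))‖ = r * ‖conj z + w + ofReal (2 * d * n)‖ := by
    rw [norm_smul, Real.norm_of_nonneg hr0.le, ← norm_conj, conj_add_conj_add_ofReal]
  rw [cscTerm, h1, ← smul_add, h2, conj_smul, ← smul_add, conj_add, conj_conj, szegoTerm,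
    smul_smul, smul_smul]
  congr 1
  field_simp

end series

/-! ### The reproducing property and the Hardy space -/

section hardy

variable {d : ℝ} {w : Octonion} {f g : Octonion → Octonion}

/-- Substituting z̄ = 2t - z, valid on this hyperplane only, turns the conjugated term into a
translated Cauchy kernel. -/
lemma conj_szegoTerm_slice (d t : ℝ) (w : Octonion) (n : ℤ) (x : EuclideanSpace ℝ (Fin 7)) :
    conj (szegoTerm d (slice t x) w n) =
      -((-1 : ℝ) ^ n • cauchyKernel 0 (slice t x - (w + ofReal (2 * d * n + 2 * t)))) := by
  have h1 : slice t x + conj w + ofReal (2 * d * n) =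
      -conj (slice t x - (w + ofReal (2 * d * n + 2 * t))) := by
    rw [conj_sub, conj_add, conj_ofReal]
    have h2 : conj (slice t x) = ofReal (2 * t) - slice t x := by
      apply ext_coord; intro i
      fin_cases i <;> simp [ofReal, e_coord]
      ring
    rw [h2, ofReal_add]
    abel
  rw [szegoTerm_eq, cauchyKernel, cauchyKernel, h1, norm_neg, norm_conj, conj_smul, conj_smul,
    conj_neg, conj_neg, conj_conj, smul_neg, smul_neg]

/-- The pairing with the series can be computed termwise on each boundary hyperplane. -/
lemma hasSum_integral_conj_szegoTerm_mul (hw : w ∈ strip d) (hf : f ∈ hardyCore d) {t : ℝ}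
    (ht : t ∈ Set.Icc 0 d) :
    HasSum (fun n => ∫ x, conj (szegoTerm d (slice t x) w n) * f (slice t x))
      (∫ x, conj (szegoSeries d (slice t x) w) * f (slice t x)) := by
  have hd : 0 < d := hw.1.trans hw.2
  have hfs := continuous_comp_slice hd hf.2.1 ht
  have hmem := slice_mem_closure_strip hd ht
  have hterm : ∀ n, Continuous fun x => szegoTerm d (slice t x) w n := fun n =>
    (continuousOn_szegoTerm hw n).comp_continuous (continuous_slice t) hmem
  obtain ⟨C, hC, h⟩ := exists_norm_szegoTerm_le hw
  have hsum : ∀ x, Summable fun n => seriesWeight n *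
      (C ^ 2 * ((1 + ‖x - 0‖ ^ 2) ^ 5)⁻¹ + ‖f (slice t x)‖ ^ 2) := fun x =>
    summable_seriesWeight.mul_right _
  refine hasSum_integral_of_dominated_convergence (fun n x => seriesWeight n *
      (C ^ 2 * ((1 + ‖x - 0‖ ^ 2) ^ 5)⁻¹ + ‖f (slice t x)‖ ^ 2))
    (fun n => ((continuous_conj.comp (hterm n)).mul hfs).aestronglyMeasurable)
    (fun n => Eventually.of_forall fun x => ?_) (Eventually.of_forall hsum) ?_
    (Eventually.of_forall fun x => ?_)
  · rw [norm_mul_oct, norm_conj]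
    calc _ ≤ seriesWeight n * (C * ((1 + ‖slice t x‖) ^ 5)⁻¹) * ‖f (slice t x)‖ := by
          gcongr; exact (h _ (hmem x) n).2.1
      _ = seriesWeight n * (C * ((1 + ‖slice t x‖) ^ 5)⁻¹ * ‖f (slice t x)‖) := by ring
      _ ≤ seriesWeight n * ((C * ((1 + ‖slice t x‖) ^ 5)⁻¹) ^ 2 + ‖f (slice t x)‖ ^ 2) :=
          mul_le_mul_of_nonneg_left (mul_le_add_sq _ _) (seriesWeight_nonneg n)
      _ ≤ _ := by
          have := seriesWeight_nonneg n
          rw [mul_pow]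
          gcongr
          exact inv_one_add_norm_slice_le t x
  · simp only [tsum_mul_right]
    exact ((integrable_slice_bound.const_mul _).add
      (integrable_norm_sq_slice hd hf ht)).const_mul _
  · have h1 := (summable_szegoTerm hw (hmem x)).hasSum
    have h2 := h1.mapL conjLI.toContinuousLinearMap
    exact h2.mapL (mulL.flip (f (slice t x)))

lemma pole_notMem (hw : w ∈ strip d) {m : ℤ} (hm : m ≠ 0) :
    w + ofReal (2 * d * m) ∉ closure (strip d) := by
  obtain ⟨hw0, hwd⟩ := hw
  rw [closure_strip (hw0.trans hwd)]
  rintro ⟨h1, h2⟩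
  rw [PiLp.add_apply, ofReal_coord0] at h1 h2
  rcases lt_or_gt_of_ne hm with h | h
  · have : (m : ℝ) ≤ -1 := by exact_mod_cast Int.le_sub_one_of_lt h
    nlinarith
  · have : (1 : ℝ) ≤ m := by exact_mod_cast h
    nlinarith

/-- The two hyperplanes see the same poles w + 2dm with opposite signs, so each m contributes a
Cauchy integral over the whole boundary. -/
theorem integral_conj_szegoSeries_mul (hw : w ∈ strip d) (hf : f ∈ hardyCore d) :
    (∫ x, conj (szegoSeries d (slice 0 x) w) * f (slice 0 x)) +
      ∫ x, conj (szegoSeries d (slice d x) w) * f (slice d x) = (Real.pi ^ 4 / 3) • f w := by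
  have hd : 0 < d := hw.1.trans hw.2
  let I : ℝ → ℤ → Octonion := fun t m =>
    ∫ x, cauchyKernel 0 (slice t x - (w + ofReal (2 * d * m))) * f (slice t x)
  have hI : ∀ (t : ℝ) (n m : ℤ), 2 * d * n + 2 * t = 2 * d * m →
      ∫ x, conj (szegoTerm d (slice t x) w n) * f (slice t x) = -((-1 : ℝ) ^ n • I t m) := by
    intro t n m h
    simp only [conj_szegoTerm_slice, h, neg_mul_oct, smul_mul_oct]
    rw [integral_neg, integral_smul]
  have h0 : HasSum (fun m => -((-1 : ℝ) ^ m • I 0 m))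
      (∫ x, conj (szegoSeries d (slice 0 x) w) * f (slice 0 x)) := by
    refine (hasSum_integral_conj_szegoTerm_mul hw hf ⟨le_rfl, hd.le⟩).congr_fun fun m => ?_
    exact (hI 0 m m (by ring)).symm
  have h1 : HasSum (fun m => (-1 : ℝ) ^ m • I d m)
      (∫ x, conj (szegoSeries d (slice d x) w) * f (slice d x)) := by
    have h2 := hasSum_integral_conj_szegoTerm_mul hw hf ⟨hd.le, le_rfl⟩
    -- At t = d the n-th pole is w + 2d(n + 1). Reindexing by m = n + 1 aligns the poles and flips
    -- the sign.
    rw [← (Equiv.subRight (1 : ℤ)).hasSum_iff] at h2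
    refine h2.congr_fun fun m => ?_
    simp only [Function.comp_apply, Equiv.subRight_apply]
    rw [hI d (m - 1) m (by push_cast; ring), zpow_sub_one₀ (by norm_num)]
    simp
  have h3 := (h0.add h1).unique (hasSum_single 0 fun m hm => ?_)
  · rw [h3]
    have := integral_cauchyKernel_of_mem hd hf hw
    simp only [I, zpow_zero, one_smul, Int.cast_zero, mul_zero]
    rw [show ofReal 0 = 0 from zero_smul ℝ _, add_zero, ← this]
    abel
  · have := integral_cauchyKernel_of_notMem hd hf (pole_notMem hw hm)
    rw [neg_add_eq_sub, ← smul_sub]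
    change (-1 : ℝ) ^ m • (I d m - I 0 m) = 0
    rw [show I d m - I 0 m = 0 from this, smul_zero]

lemma memLp_of_mem_hardyCore (hd : 0 < d) (hf : f ∈ hardyCore d) :
    MemLp f 2 (boundaryMeasure d) := by
  have h : ∀ t ∈ Set.Icc 0 d,
      MemLp f 2 ((volume : Measure (EuclideanSpace ℝ (Fin 7))).map (slice t)) := fun t ht => by
    rw [(measurableEmbedding_slice t).memLp_map_measure_iff]
    exact (memLp_two_iff_integrable_sq_norm
      (continuous_comp_slice hd hf.2.1 ht).aestronglyMeasurable).2
      (integrable_norm_sq_slice hd hf ht)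
  have h0 := h 0 ⟨le_rfl, hd.le⟩
  have h1 := h d ⟨hd.le, le_rfl⟩
  have hm := h0.1.add_measure h1.1
  exact (memLp_two_iff_integrable_sq_norm hm).2
    (((memLp_two_iff_integrable_sq_norm h0.1).1 h0).add_measure
      ((memLp_two_iff_integrable_sq_norm h1.1).1 h1))

lemma hardyCore_subset_hardySpace (hd : 0 < d) : hardyCore d ⊆ hardySpace d := fun f hf =>
  ⟨hf.1, memLp_of_mem_hardyCore hd hf, fun _ => f, fun _ => hf, by simp, fun _ _ =>
    tendsto_const_nhds⟩

lemma szegoSeries_mem_hardySpace (hw : w ∈ strip d) :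
    (fun z => szegoSeries d z w) ∈ hardySpace d :=
  hardyCore_subset_hardySpace (hw.1.trans hw.2) (szegoSeries_mem_hardyCore hw)

lemma nnnorm_mul_oct (a b : Octonion) : ‖a * b‖₊ = ‖a‖₊ * ‖b‖₊ :=
  NNReal.eq (norm_mul_oct a b)

lemma memLp_conj {μ : Measure Octonion} (hg : MemLp g 2 μ) : MemLp (fun z => conj (g z)) 2 μ :=
  conjLI.toContinuousLinearMap.comp_memLp' hg

lemma integrable_conj_mul {μ : Measure Octonion} (hf : MemLp f 2 μ) (hg : MemLp g 2 μ) :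
    Integrable (fun z => conj (g z) * f z) μ := by
  rw [← memLp_one_iff_integrable]
  exact MemLp.of_bilin (fun a b => a * b) 1 (memLp_conj hg) hf
    ((memLp_conj hg).1.mul hf.1)
    (Eventually.of_forall fun z => by
      rw [one_mul, ← nnnorm_mul_oct])

lemma hardyInner_szegoSeries_of_mem_hardyCore (hw : w ∈ strip d) (hf : f ∈ hardyCore d) :
    hardyInner d f (fun z => szegoSeries d z w) = f w := by
  have hd : 0 < d := hw.1.trans hw.2
  have hpi := Real.pi_pos
  have hint := integrable_conj_mul (memLp_of_mem_hardyCore hd hf)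
    (memLp_of_mem_hardyCore hd (szegoSeries_mem_hardyCore hw))
  rw [boundaryMeasure, integrable_add_measure] at hint
  rw [hardyInner, boundaryMeasure, integral_add_measure hint.1 hint.2,
    (measurableEmbedding_slice 0).integral_map, (measurableEmbedding_slice d).integral_map,
    integral_conj_szegoSeries_mul hw hf, smul_smul]
  convert one_smul ℝ (f w)
  field_simp

/-- Continuity of the pairing in its first argument, by the Cauchy–Schwarz inequality. -/
lemma tendsto_hardyInner {u : ℕ → Octonion → Octonion}
    (hu : ∀ k, MemLp (u k) 2 (boundaryMeasure d)) (hf : MemLp f 2 (boundaryMeasure d))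
    (hg : MemLp g 2 (boundaryMeasure d))
    (h : Tendsto (fun k => eLpNorm (u k - f) 2 (boundaryMeasure d)) atTop (𝓝 0)) :
    Tendsto (fun k => hardyInner d (u k) g) atTop (𝓝 (hardyInner d f g)) := by
  refine Tendsto.const_smul ?_ _
  refine tendsto_integral_of_L1' _ (integrable_conj_mul hf hg).1
    (Eventually.of_forall fun k => integrable_conj_mul (hu k) hg) ?_
  have h1 : Tendsto (fun k => 1 * eLpNorm (fun z => conj (g z)) 2 (boundaryMeasure d) *
      eLpNorm (u k - f) 2 (boundaryMeasure d)) atTop (𝓝 0) := by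
    have := ENNReal.Tendsto.const_mul (a := 1 * eLpNorm (fun z => conj (g z)) 2 (boundaryMeasure d))
      h (Or.inr (by rw [one_mul]; exact (memLp_conj hg).2.ne))
    rwa [mul_zero] at this
  refine tendsto_of_tendsto_of_tendsto_of_le_of_le tendsto_const_nhds h1 (fun k => zero_le)
    fun k => ?_
  have h2 := eLpNorm_le_eLpNorm_mul_eLpNorm_of_nnnorm (p := 2) (q := 2) (r := 1)
    (memLp_conj hg).1 ((hu k).sub hf).1 (fun a b => a * b) 1
    (Eventually.of_forall fun z => by rw [one_mul, ← nnnorm_mul_oct])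
  refine le_trans (le_of_eq ?_) h2
  congr 1
  ext1 z
  simp only [Pi.sub_apply, mul_sub_oct]

theorem isSzegoKernel_szegoSeries (hd : 0 < d) : IsSzegoKernel d (szegoSeries d) := by
  intro w hw
  have hS := szegoSeries_mem_hardySpace hw
  refine ⟨hS, fun f hf => ?_⟩
  obtain ⟨-, hf2, u, hu, hu2, huw⟩ := hf
  have h := tendsto_hardyInner (fun k => memLp_of_mem_hardyCore hd (hu k)) hf2 hS.2.1 hu2
  simp only [fun k => hardyInner_szegoSeries_of_mem_hardyCore hw (hu k)] at h
  exact tendsto_nhds_unique (huw w hw) h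

lemma leftRegularOn_sub {U : Set Octonion} (hf : LeftRegularOn f U) (hg : LeftRegularOn g U) :
    LeftRegularOn (f - g) U := by
  intro z hz
  obtain ⟨hf1, hf2⟩ := hf z hz
  obtain ⟨hg1, hg2⟩ := hg z hz
  refine ⟨hf1.sub hg1, ?_⟩
  simp only [fderiv_sub hf1 hg1, sub_apply, mul_sub_oct, Finset.sum_sub_distrib, hf2, hg2,
    sub_zero]

lemma hardyCore_sub (hd : 0 < d) (hf : f ∈ hardyCore d) (hg : g ∈ hardyCore d) :
    f - g ∈ hardyCore d := by
  obtain ⟨hf1, hf2, C, hC⟩ := hf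
  obtain ⟨hg1, hg2, D, hD⟩ := hg
  refine ⟨leftRegularOn_sub hf1 hg1, hf2.sub hg2, 2 * C + 2 * D, fun t ht => ?_⟩
  have hfm := (continuous_comp_slice hd hf2 ht).enorm.measurable.pow_const 2
  calc _ ≤ ∫⁻ x, (2 * ‖f (slice t x)‖ₑ ^ 2 + 2 * ‖g (slice t x)‖ₑ ^ 2) := by
        refine lintegral_mono fun x => ?_
        simp only [← ofReal_norm, ← ENNReal.ofReal_pow (norm_nonneg _)]
        have h2 : ∀ s : ℝ, 2 * ENNReal.ofReal s = ENNReal.ofReal (2 * s) := fun s => by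
          rw [ENNReal.ofReal_mul zero_le_two, ENNReal.ofReal_ofNat]
        rw [h2, h2, ← ENNReal.ofReal_add (by positivity) (by positivity)]
        refine ENNReal.ofReal_le_ofReal ?_
        have h := norm_sub_le (f (slice t x)) (g (slice t x))
        rw [Pi.sub_apply]
        nlinarith [sq_nonneg (‖f (slice t x)‖ - ‖g (slice t x)‖),
          norm_nonneg (f (slice t x) - g (slice t x))]
    _ = 2 * (∫⁻ x, ‖f (slice t x)‖ₑ ^ 2) + 2 * ∫⁻ x, ‖g (slice t x)‖ₑ ^ 2 := by
        rw [lintegral_add_left (hfm.const_mul 2), lintegral_const_mul' _ _ (by simp),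
          lintegral_const_mul' _ _ (by simp)]
    _ ≤ 2 * C + 2 * D := by gcongr; exacts [hC t ht, hD t ht]
    _ = _ := by push_cast; rfl

lemma hardySpace_sub (hd : 0 < d) (hf : f ∈ hardySpace d) (hg : g ∈ hardySpace d) :
    f - g ∈ hardySpace d := by
  obtain ⟨hf1, hf2, u, hu, hu2, huw⟩ := hf
  obtain ⟨hg1, hg2, v, hv, hv2, hvw⟩ := hg
  refine ⟨leftRegularOn_sub hf1 hg1, hf2.sub hg2, fun k => u k - v k,
    fun k => hardyCore_sub hd (hu k) (hv k), ?_, fun z hz => (huw z hz).sub (hvw z hz)⟩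
  have h := hu2.add hv2
  rw [add_zero] at h
  refine tendsto_of_tendsto_of_tendsto_of_le_of_le tendsto_const_nhds h (fun k => zero_le)
    fun k => ?_
  rw [sub_sub_sub_comm]
  exact eLpNorm_sub_le ((memLp_of_mem_hardyCore hd (hu k)).sub hf2).1
    ((memLp_of_mem_hardyCore hd (hv k)).sub hg2).1 (by norm_num)

/-- A function of the Hardy space that is orthogonal to itself vanishes on the boundary. -/
lemma ae_eq_zero_of_hardyInner_self (hf : MemLp f 2 (boundaryMeasure d))
    (h : hardyInner d f f = 0) : ∀ᵐ z ∂(boundaryMeasure d), f z = 0 := by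
  have hi := (memLp_two_iff_integrable_sq_norm hf.1).1 hf
  simp only [hardyInner, conj_mul_self, ofReal] at h
  rw [integral_smul_const] at h
  have hpi := Real.pi_pos
  have h1 : ∫ z, ‖f z‖ ^ 2 ∂(boundaryMeasure d) = 0 := by
    have he : e 0 ≠ 0 := norm_pos_iff.1 (by rw [norm_e]; exact one_pos)
    have h3 : 3 / Real.pi ^ 4 ≠ 0 := by positivity
    simpa [smul_eq_zero, he, hpi.ne'] using h
  rw [integral_eq_zero_iff_of_nonneg (fun z => by positivity) hi] at h1
  filter_upwards [h1] with z hz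
  simpa using hz

lemma summable_of_const_smul {u : ℤ → Octonion} {r : ℝ} (hr : r ≠ 0)
    (h : Summable fun n => r • u n) : Summable u := by
  have h1 := h.const_smul r⁻¹
  simpa only [smul_smul, inv_mul_cancel₀ hr, one_smul] using h1

lemma hardyInner_sub_right {h : Octonion → Octonion} (hf : MemLp f 2 (boundaryMeasure d))
    (hg : MemLp g 2 (boundaryMeasure d)) (hh : MemLp h 2 (boundaryMeasure d)) :
    hardyInner d f (g - h) = hardyInner d f g - hardyInner d f h := by
  simp only [hardyInner, Pi.sub_apply, conj_sub, sub_mul_oct]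
  rw [integral_sub (integrable_conj_mul hf hg) (integrable_conj_mul hf hh), smul_sub]

lemma hardyInner_eq_zero_of_ae_eq_zero (hf : ∀ᵐ z ∂(boundaryMeasure d), f z = 0) :
    hardyInner d f g = 0 := by
  rw [hardyInner, integral_eq_zero_of_ae, smul_zero]
  filter_upwards [hf] with z hz
  rw [hz, mul_zero_oct, Pi.zero_apply]

end hardy

end Octonion

end

/-! ### Uniqueness and the cosecant form -/

theorem mainTheorem1 (d : ℝ) (hd : 0 < d) :
    -- the series is the (unique) Szegő kernel of the strip
    Octonion.IsSzegoKernel d (Octonion.szegoSeries d) ∧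
    (∀ K : Octonion → Octonion → Octonion, Octonion.IsSzegoKernel d K →
      ∀ w ∈ Octonion.strip d,
        (∀ z ∈ Octonion.strip d, K z w = Octonion.szegoSeries d z w) ∧
        (∀ᵐ z ∂(Octonion.boundaryMeasure d), K z w = Octonion.szegoSeries d z w)) ∧
    -- both series converge (unconditionally) and the kernel is the rescaled cosecant
    (∀ w ∈ Octonion.strip d, ∀ z ∈ closure (Octonion.strip d),
      Summable (Octonion.szegoTerm d z w) ∧
      Summable (Octonion.cscTerm ((Real.pi / (2 * d)) • (z + Octonion.conj w))) ∧
      Octonion.szegoSeries d z w =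
        (Real.pi / (2 * d)) ^ 7 •
          Octonion.csc ((Real.pi / (2 * d)) • (z + Octonion.conj w))) := by
  have hS := Octonion.isSzegoKernel_szegoSeries hd
  refine ⟨hS, fun K hK w hw => ?_, fun w hw z hz => ?_⟩
  · obtain ⟨hK1, hK2⟩ := hK w hw
    obtain ⟨hS1, hS2⟩ := hS w hw
    have hg := Octonion.hardySpace_sub hd hK1 hS1
    -- For g = K(·,w) - S(·,w), both kernels reproduce g(w), hence (g,g) = 0.
    have hself := Octonion.ae_eq_zero_of_hardyInner_self hg.2.1 (by
      rw [Octonion.hardyInner_sub_right hg.2.1 hK1.2.1 hS1.2.1, ← hK2 _ hg, ← hS2 _ hg, sub_self])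
    refine ⟨fun z hz => ?_, ?_⟩
    -- Values inside the strip are recovered from the vanishing boundary values by pairing with
    -- S(·,z).
    · have h := (hS z hz).2 _ hg
      rw [Octonion.hardyInner_eq_zero_of_ae_eq_zero hself] at h
      exact sub_eq_zero.1 h
    · filter_upwards [hself] with z hz
      exact sub_eq_zero.1 hz
  · have hsum := Octonion.summable_szegoTerm hw hz
    have hr : (Real.pi / (2 * d)) ^ 7 ≠ 0 := by have := Real.pi_pos; positivity
    have heq : Octonion.szegoTerm d z w = fun n => (Real.pi / (2 * d)) ^ 7 •
        Octonion.cscTerm ((Real.pi / (2 * d)) • (z + Octonion.conj w)) n :=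
      funext fun n => Octonion.szegoTerm_eq_smul_cscTerm hd z w n
    have hcsc : Summable (Octonion.cscTerm ((Real.pi / (2 * d)) • (z + Octonion.conj w))) := by
      rw [heq] at hsum
      exact Octonion.summable_of_const_smul hr hsum
    refine ⟨hsum, hcsc, ?_⟩
    rw [Octonion.szegoSeries, heq]
    exact hcsc.tsum_const_smul _
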